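/- Let $M$ be an oriented smooth $n$-manifold (Hausdorff, $\sigma$-compact, without boundary, possibly non-compact), $P\to M$ a smooth principal bundle with structure group a Lie group $G$, and $\mathfrak X_{inv}(P)$ the Lie algebra of the group $\mathrm{Aut}(P)$, i.e. the $G$-invariant vector fields on $P$ with the bracket of $\mathrm{Lie}(\mathrm{Aut}(P))$ (minus the bracket of vector fields). *Fields and local forms.* Let $Y\to Y_0\to M$ be a graded gauge natural bundle associated to $P$: a graded vector bundle of finite rank (fibre coordinates of non-zero degrees) over a bundle $Y_0$ over $M$, both associated to the principal bundle $W^{r,s}P=J^rP\times_M L^s(M)$, for some $r\le s$. Let $\Gamma(Y)$ be the graded manifold of its sections, on which $\mathrm{Aut}(P)$ acts. A local form of degree $(p,0,d)$ is a $p$-form on $M$ that depends on the fields $\Phi\in\Gamma(Y)$ locally, through finite jets (smoothly in the fields of degree $0$, polynomially in the others), and has ghost number $d$; $d_h$ is the de Rham differential along $M$. (A form with $p=0$ is called $d_h$-exact only if it is zero.) $\mathrm{Loc}(\Gamma(Y))$ is the span of the functions $\int_\gamma\alpha$ on $\Gamma(Y)$, where $\gamma\subset M$ is an oriented embedded submanifold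 and $\alpha$ is a local form with compact support along $\gamma$. A vertical local vector field of degree $d$ is a vector field on $\Gamma(Y)$ of degree $d$ (a graded derivation of functions) that maps local forms to local forms and acts on $\int_\gamma\alpha$ by acting on $\alpha$. For $\Xi\in\mathfrak X_{inv}(P)$ let $\xi_\Xi$ be the vertical local vector field given by the infinitesimal action of $\Xi$ on fields (Lie derivative). *Structures.* A $QKG^\star$-structure consists of vertical local vector fields $Q$ of degree $1$ and $K_\Xi$ of degree $-1$, linear in $\Xi\in\mathfrak X_{inv}(P)$, with $$Q^2=0,\quad [Q,K_\Xi]=\xi_\Xi,\quad [K_{\Xi_1},K_{\Xi_2}]=0,\quad [\xi_{\Xi_1},K_{\Xi_2}]=K_{[\Xi_1,\Xi_2]}.$$ In a deformed $QKG^\star$-structure, $K_\Xi$ is replaced by $K_\Xi+tK'_\Xi$, with $t\in\mathbb R$ and vertical local vector fields $K'_\Xi$ of degree $-1$ such that $[Q,K'_\Xi]=0$ and $[K'_{\Xi_1},K'_{\Xi_2}]=0$; below, $K_\Xi$ denotes the possibly deformed field. For $G$ trivial and $P=M$, so that $\Xi=X\in\mathfrak X(M)$, this is a (deformed) $QK^\star$-structure.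 A vertical local vector field $D$ of degree $d$ is a Noether symmetry of a local form $\mathcal L$ of degree $(n,0,0)$ if $D\mathcal L=d_h\alpha$ for some local form $\alpha$ of degree $(n-1,0,d)$. A *CohLFT* consists of $Y$ (with $G$ trivial, $P=M$), a (deformed) $QK^\star$-structure and a Lagrangian $\mathcal L$ of degree $(n,0,0)$, with compact support along $M$, such that $Q$ is a Noether symmetry. A *CohLGFT* is the same with $P$ arbitrary and a (deformed) $QKG^\star$-structure, where moreover $I_\lambda=K_\lambda$ and $\delta_\lambda=\xi_\lambda$ are Noether symmetries for all vertical $\lambda\in\mathfrak X_{inv}(P)$. A *preobservable* is a local form $\mathcal O$ of vertical degree $0$ for which $Q\mathcal O$ is $d_h$-exact and, in the case of a CohLGFT, $I_\lambda\mathcal O=\delta_\lambda\mathcal O=0$ for all vertical $\lambda$. If $\mathcal O$ has horizontal degree $p$ and $\gamma\subset M$ is a compact oriented embedded $p$-dimensional submanifold without boundary, put $O[\gamma]=\int_\gamma\mathcal O$; the action is $S=\int_M\mathcal L$. **Theorem.** (1) In a CohLFT, $O[\gamma]$ and $S$ are $\mathrm{Diff}(M)$-invariant up to $Q$-exact terms: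 for every $X\in\mathfrak X(M)$, every preobservable $\mathcal O$ and every $\gamma$ as above, $$\xi_X(O[\gamma])=Q\Big(\int_\gamma K_X\mathcal O\Big),\qquad \xi_X(S)=Q\Big(\int_M K_X\mathcal L\Big).$$ (2) In a CohLGFT, $O[\gamma]$ and $S$ are $\mathrm{Aut}(P)$-invariant up to $Q$-exact terms: for every $\Xi\in\mathfrak X_{inv}(P)$, every preobservable $\mathcal O$ and every $\gamma$ as above, $$\xi_\Xi(O[\gamma])=Q\Big(\int_\gamma K_\Xi\mathcal O\Big),\qquad \xi_\Xi(S)=Q\Big(\int_M K_\Xi\mathcal L\Big).$$ These are equalities of functions on $\Gamma(Y)$; all the integrals lie in $\mathrm{Loc}(\Gamma(Y))$. -/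

import Mathlib

open Set Filter Topology MeasureTheory Bundle
open scoped Manifold ContDiff

universe u v w v₁ w₁ x

noncomputable section

namespace CohLFT

/-- The model space `ℝⁿ`. -/
abbrev Euc (n : ℕ) : Type := EuclideanSpace ℝ (Fin n)

/-! ### Differential forms on a manifold, exterior derivative, integration -/

section Forms

variable {n m : ℕ} (M : Type u) [TopologicalSpace M] [ChartedSpace (Euc n) M]
  {N : Type v} [TopologicalSpace N] [ChartedSpace (Euc m) N]

/-- (Not necessarily smooth) differential `p`-forms on an `n`-manifold. -/
abbrev Form (n : ℕ) (M : Type u) [TopologicalSpace M] [ChartedSpace (Euc n) M] (p : ℕ) : Type u :=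
  ∀ y : M, TangentSpace 𝓘(ℝ, Euc n) y [⋀^Fin p]→L[ℝ] ℝ

variable {M}

/-- Pull-back of a form along a map. -/
def Form.pullback {p : ℕ} (f : N → M) (θ : Form n M p) : Form m N p := fun y =>
  (θ (f y)).compContinuousLinearMap (mfderiv 𝓘(ℝ, Euc m) 𝓘(ℝ, Euc n) f y)

/-- The expression of a form in the preferred chart at `y₀`, a form on (an open part of) `ℝⁿ`. -/
def Form.inChart {p : ℕ} (θ : Form n M p) (y₀ : M) : Euc n → Euc n [⋀^Fin p]→L[ℝ] ℝ := fun a =>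
  (θ ((extChartAt 𝓘(ℝ, Euc n) y₀).symm a)).compContinuousLinearMap
    (mfderiv 𝓘(ℝ, Euc n) 𝓘(ℝ, Euc n) (extChartAt 𝓘(ℝ, Euc n) y₀).symm a)

/-- The exterior derivative, computed at each point in the preferred chart at that point. -/
def Form.d {p : ℕ} (θ : Form n M p) : Form n M (p + 1) := fun y =>
  (extDeriv (θ.inChart y) (extChartAt 𝓘(ℝ, Euc n) y y)).compContinuousLinearMap
    (mfderiv 𝓘(ℝ, Euc n) 𝓘(ℝ, Euc n) (extChartAt 𝓘(ℝ, Euc n) y) y)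

/-- The sign `±1` that tells whether, at the point `z`, the preferred chart at `y` has the same
orientation as the preferred chart at `z` (which identifies the tangent space at `z` with `ℝⁿ`). -/
def chartSign (n : ℕ) {M : Type u} [TopologicalSpace M] [ChartedSpace (Euc n) M] (y z : M) : ℝ :=
  let A : Euc n →L[ℝ] Euc n := mfderiv 𝓘(ℝ, Euc n) 𝓘(ℝ, Euc n) (extChartAt 𝓘(ℝ, Euc n) y) z
  SignType.sign (LinearMap.det (A : Euc n →ₗ[ℝ] Euc n))

/-- An orientation of an `n`-manifold. The preferred chart at `y` identifies the tangent space at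
`y` with `ℝⁿ`; `sign y = 1` if the standard basis of `ℝⁿ` is a positive basis there, and
`sign y = -1` otherwise. The condition says that the orientation varies continuously. -/
structure MfdOrientation (n : ℕ) (M : Type u) [TopologicalSpace M] [ChartedSpace (Euc n) M] where
  sign : M → ℝ
  sign_eq : ∀ y, sign y = 1 ∨ sign y = -1
  continuous : ∀ y : M, ∀ᶠ z in 𝓝 y, sign z * chartSign n y z = sign y

/-- A smooth partition of unity subordinate to the preferred charts. -/
def chartPartition (n : ℕ) (M : Type u) [TopologicalSpace M] [ChartedSpace (Euc n) M]
    [IsManifold 𝓘(ℝ, Euc n) ∞ M] [T2Space M] [SigmaCompactSpace M] :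
    SmoothPartitionOfUnity M 𝓘(ℝ, Euc n) M univ :=
  (SmoothPartitionOfUnity.exists_isSubordinate_chartAt_source 𝓘(ℝ, Euc n) M).choose

/-- The integral of a (smooth, compactly supported) top degree form over an oriented manifold. -/
def integral [IsManifold 𝓘(ℝ, Euc n) ∞ M] [T2Space M] [SigmaCompactSpace M]
    (o : MfdOrientation n M) (θ : Form n M n) : ℝ :=
  ∑ᶠ y : M, ∫ a in (extChartAt 𝓘(ℝ, Euc n) y).target,
    chartPartition n M y ((extChartAt 𝓘(ℝ, Euc n) y).symm a) *
    (o.sign ((extChartAt 𝓘(ℝ, Euc n) y).symm a) *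
      chartSign n y ((extChartAt 𝓘(ℝ, Euc n) y).symm a)) *
    θ.inChart y a (fun i => EuclideanSpace.basisFun (Fin n) ℝ i)

/-- An oriented embedded `p`-dimensional submanifold of `M` (without boundary), given by its
inclusion map. -/
structure Submfd (n : ℕ) (M : Type u) [TopologicalSpace M] [ChartedSpace (Euc n) M] (p : ℕ) where
  carrier : Type u
  [top : TopologicalSpace carrier]
  [charted : ChartedSpace (Euc p) carrier]
  [mfd : IsManifold 𝓘(ℝ, Euc p) ∞ carrier]
  [t2 : T2Space carrier]
  [sigmaCompact : SigmaCompactSpace carrier]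
  orientation : MfdOrientation p carrier
  incl : carrier → M
  contMDiff_incl : ContMDiff 𝓘(ℝ, Euc p) 𝓘(ℝ, Euc n) ∞ incl
  isEmbedding_incl : IsEmbedding incl
  immersive : ∀ y, Function.Injective (mfderiv 𝓘(ℝ, Euc p) 𝓘(ℝ, Euc n) incl y)

attribute [instance] Submfd.top Submfd.charted Submfd.mfd Submfd.t2 Submfd.sigmaCompact

/-- The integral over a submanifold of a form on the ambient manifold. -/
def Submfd.integrate {p : ℕ} (γ : Submfd n M p) (θ : Form n M p) : ℝ :=
  integral γ.orientation (θ.pullback γ.incl)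

/-- The whole oriented manifold `M`, as a submanifold of itself. -/
def Submfd.whole [IsManifold 𝓘(ℝ, Euc n) ∞ M] [T2Space M] [SigmaCompactSpace M]
    (o : MfdOrientation n M) : Submfd n M n where
  carrier := M
  orientation := o
  incl := id
  contMDiff_incl := contMDiff_id
  isEmbedding_incl := IsEmbedding.id
  immersive := fun y => by rw [mfderiv_id]; exact fun _ _ h => h

end Forms

/-! ### Principal bundles, their automorphisms and their invariant vector fields -/

section Principal

variable (n : ℕ) (M : Type u) [TopologicalSpace M] [ChartedSpace (Euc n) M]
  (EG : Type v₁) [NormedAddCommGroup EG] [NormedSpace ℝ EG]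
  (G : Type v) [TopologicalSpace G] [ChartedSpace EG G] [Group G]
  (EP : Type w₁) [NormedAddCommGroup EP] [NormedSpace ℝ EP]
  (P : Type w) [TopologicalSpace P] [ChartedSpace EP P]
  [IsManifold 𝓘(ℝ, EP) ∞ P]

/-- A smooth principal (right) `G`-bundle `P → M`. Local triviality is expressed through a local
section `σ` and the map `τ` with `q = σ(π(q)) · τ(q)`. -/
structure PrincipalBundle where
  proj : P → M
  act : P → G → P
  contMDiff_proj : ContMDiff 𝓘(ℝ, EP) 𝓘(ℝ, Euc n) ∞ proj
  contMDiff_act : ContMDiff (𝓘(ℝ, EP).prod 𝓘(ℝ, EG)) 𝓘(ℝ, EP) ∞ (fun q : P × G => act q.1 q.2)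
  act_one : ∀ q, act q 1 = q
  act_mul : ∀ q g h, act q (g * h) = act (act q g) h
  proj_act : ∀ q g, proj (act q g) = proj q
  locally_trivial : ∀ y : M, ∃ U : Set M, IsOpen U ∧ y ∈ U ∧ ∃ (σ : M → P) (τ : P → G),
    ContMDiffOn 𝓘(ℝ, Euc n) 𝓘(ℝ, EP) ∞ σ U ∧
    ContMDiffOn 𝓘(ℝ, EP) 𝓘(ℝ, EG) ∞ τ (proj ⁻¹' U) ∧
    (∀ z ∈ U, proj (σ z) = z) ∧
    ∀ q ∈ proj ⁻¹' U, ∀ g, act (σ (proj q)) g = q ↔ g = τ q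

variable {n M EG G EP P}

/-- An automorphism of a principal bundle: an equivariant diffeomorphism `total` of `P`, with the
diffeomorphism `base` of `M` that it covers. -/
structure BundleAut (B : PrincipalBundle n M EG G EP P) where
  total : P ≃ₘ^∞⟮𝓘(ℝ, EP), 𝓘(ℝ, EP)⟯ P
  base : M ≃ₘ^∞⟮𝓘(ℝ, Euc n), 𝓘(ℝ, Euc n)⟯ M
  equivariant : ∀ q g, total (B.act q g) = B.act (total q) g
  covers : ∀ q, B.proj (total q) = base (B.proj q)

/-- A smooth `G`-invariant vector field on `P`. -/
structure InvField (B : PrincipalBundle n M EG G EP P) where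
  toFun : ∀ q : P, TangentSpace 𝓘(ℝ, EP) q
  smooth : ContMDiff 𝓘(ℝ, EP) 𝓘(ℝ, EP).tangent ∞
    (fun q => (⟨q, toFun q⟩ : TangentBundle 𝓘(ℝ, EP) P))
  invariant : ∀ (g : G) (q : P),
    mfderiv 𝓘(ℝ, EP) 𝓘(ℝ, EP) (fun q' => B.act q' g) q (toFun q) = toFun (B.act q g)

/-- `Ξ` is vertical, i.e. an infinitesimal gauge transformation (a section of `ad P`). -/
def InvField.IsVertical {B : PrincipalBundle n M EG G EP P} (Ξ : InvField B) : Prop :=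
  ∀ q, mfderiv 𝓘(ℝ, EP) 𝓘(ℝ, Euc n) B.proj q (Ξ.toFun q) = 0

/-- A smooth curve of automorphisms starting at the identity. -/
structure AutCurve (B : PrincipalBundle n M EG G EP P) where
  toFun : ℝ → BundleAut B
  smooth : ContMDiff (𝓘(ℝ, ℝ).prod 𝓘(ℝ, EP)) 𝓘(ℝ, EP) ∞
    (fun z : ℝ × P => (toFun z.1).total z.2)
  at_zero : ∀ q, (toFun 0).total q = q

/-- Over the open set `U ⊆ M`, the initial velocity of the curve `A` of automorphisms is `Ξ`. -/
def AutCurve.HasVelocityOver {B : PrincipalBundle n M EG G EP P} (A : AutCurve B)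
    (Ξ : InvField B) (U : Set M) : Prop :=
  ∀ q, B.proj q ∈ U →
    (mfderiv 𝓘(ℝ, ℝ) 𝓘(ℝ, EP) (fun t : ℝ => (A.toFun t).total q) 0 (1 : ℝ) : EP) = Ξ.toFun q

/-- A frame: a smooth map `e : ℝⁿ → P` that covers a local diffeomorphism `ε = π ∘ e : ℝⁿ → M`;
so `e = σ ∘ ε` near `0` for the local section `σ = e ∘ ε⁻¹` of `P`. The pairs
`(j^r σ (ε 0), j^s ε (0))` are the points of the bundle `W^{r,s} P = J^r P ×_M L^s(M)`. -/
def Frame (B : PrincipalBundle n M EG G EP P) : Type w :=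
  {e : Euc n → P // ContMDiff 𝓘(ℝ, Euc n) 𝓘(ℝ, EP) ∞ e ∧
    ∀ a, Function.Bijective (mfderiv 𝓘(ℝ, Euc n) 𝓘(ℝ, Euc n) (fun b => B.proj (e b)) a)}

/-- The base map `ε : ℝⁿ → M` of a frame. -/
def Frame.base {B : PrincipalBundle n M EG G EP P} (e : Frame B) : Euc n → M :=
  fun a => B.proj (e.1 a)

/-- The frame `b ↦ e (a + b)`, based at the point `ε(a)`. -/
def Frame.translate {B : PrincipalBundle n M EG G EP P} (e : Frame B) (a : Euc n) : Frame B :=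
  ⟨fun b => e.1 (a + b), by
    refine ⟨e.2.1.comp (contDiff_const.add contDiff_id).contMDiff, fun b => ?_⟩
    have h1 : MDifferentiableAt 𝓘(ℝ, Euc n) 𝓘(ℝ, Euc n) (fun b => B.proj (e.1 b)) (a + b) :=
      ((B.contMDiff_proj.comp e.2.1) (a + b)).mdifferentiableAt (by simp)
    have h2 : HasMFDerivAt 𝓘(ℝ, Euc n) 𝓘(ℝ, Euc n) (fun b : Euc n => a + b) b
        (ContinuousLinearMap.id ℝ (Euc n)) :=
      ((hasFDerivAt_id b).const_add a).hasMFDerivAt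
    have h3 := HasMFDerivAt.comp b h1.hasMFDerivAt h2
    have h4 := h3.mfderiv
    have h5 := e.2.2 (a + b)
    change Function.Bijective (mfderiv 𝓘(ℝ, Euc n) 𝓘(ℝ, Euc n)
      ((fun b => B.proj (e.1 b)) ∘ fun b : Euc n => a + b) b)
    rw [h4]
    exact h5⟩

/-- The action of an automorphism of `P` on frames. -/
def BundleAut.onFrame {B : PrincipalBundle n M EG G EP P} (A : BundleAut B) (e : Frame B) :
    Frame B :=
  ⟨fun b => A.total (e.1 b), by
    refine ⟨A.total.contMDiff.comp e.2.1, fun b => ?_⟩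
    have h1 : MDifferentiableAt 𝓘(ℝ, Euc n) 𝓘(ℝ, Euc n) (fun b => B.proj (e.1 b)) b :=
      ((B.contMDiff_proj.comp e.2.1) b).mdifferentiableAt (by simp)
    have h2 : MDifferentiableAt 𝓘(ℝ, Euc n) 𝓘(ℝ, Euc n) A.base (B.proj (e.1 b)) :=
      (A.base.contMDiff _).mdifferentiableAt (by simp)
    have h3 : (fun b => B.proj (A.total (e.1 b))) = A.base ∘ (fun b => B.proj (e.1 b)) :=
      funext fun b => A.covers _
    rw [h3, mfderiv_comp b h2 h1]
    exact ((A.base.mfderivToContinuousLinearEquiv (by simp) (B.proj (e.1 b))).bijective).comp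
      (e.2.2 b)⟩

/-- The principal bundle `M → M` with trivial structure group. -/
def trivialBundle (n : ℕ) (M : Type u) [TopologicalSpace M] [ChartedSpace (Euc n) M]
    [IsManifold 𝓘(ℝ, Euc n) ∞ M] : PrincipalBundle n M PUnit.{1} PUnit.{1} (Euc n) M where
  proj := id
  act := fun q _ => q
  contMDiff_proj := contMDiff_id
  contMDiff_act := contMDiff_fst
  act_one := fun _ => rfl
  act_mul := fun _ _ _ => rfl
  proj_act := fun _ _ => rfl
  locally_trivial := fun _ => ⟨univ, isOpen_univ, mem_univ _, id, fun _ => PUnit.unit,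
    contMDiffOn_id, contMDiffOn_const, fun _ _ => rfl, fun _ _ _ => by simp⟩

end Principal

/-! ### Gauge natural bundles and their sections -/

section Fibre

variable (n : ℕ) (EG : Type v₁) [NormedAddCommGroup EG] [NormedSpace ℝ EG]
  (G : Type v) [TopologicalSpace G] [ChartedSpace EG G] [Group G]

/-- Representatives `(a, α)` of the elements `(j^r a (0), j^s α (0))` of the structure group
`W^{r,s}_n G = J^r_n G ⋊ GL^s(n)`: `a : ℝⁿ → G` is smooth and `α : ℝⁿ → ℝⁿ` is a smooth local
diffeomorphism that fixes `0`. -/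
structure GaugeGerm where
  a : Euc n → G
  α : Euc n → Euc n
  smooth_a : ContMDiff 𝓘(ℝ, Euc n) 𝓘(ℝ, EG) ∞ a
  smooth_α : ContDiff ℝ ∞ α
  α_zero : α 0 = 0
  étale : ∀ b, Function.Bijective (fderiv ℝ α b)

variable {n EG G}

/-- The unit of the structure group. -/
def GaugeGerm.one : GaugeGerm n EG G where
  a := fun _ => 1
  α := id
  smooth_a := contMDiff_const
  smooth_α := contDiff_id
  α_zero := rfl
  étale := fun b => by rw [fderiv_id]; exact Function.bijective_id

/-- The product of the structure group: `(a, α)(a', α') = ((a ∘ α') a', α ∘ α')`. -/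
def GaugeGerm.mul [LieGroup 𝓘(ℝ, EG) ∞ G] (h h' : GaugeGerm n EG G) : GaugeGerm n EG G where
  a := fun b => h.a (h'.α b) * h'.a b
  α := h.α ∘ h'.α
  smooth_a := (h.smooth_a.comp h'.smooth_α.contMDiff).mul h'.smooth_a
  smooth_α := h.smooth_α.comp h'.smooth_α
  α_zero := by simp [h.α_zero, h'.α_zero]
  étale := fun b => by
    rw [fderiv_comp b ((h.smooth_α.differentiable (by simp)) _)
      ((h'.smooth_α.differentiable (by simp)) _)]
    exact (h.étale _).comp (h'.étale b)

/-- `(a, α)` and `(a', α')` represent the same element of `W^{r,s}_n G`. -/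
def GaugeGerm.JetEq (r s : ℕ) (h h' : GaugeGerm n EG G) : Prop :=
  h.a 0 = h'.a 0 ∧
  (∀ k ≤ r, iteratedFDeriv ℝ k (fun b => extChartAt 𝓘(ℝ, EG) (h.a 0) (h.a b)) 0 =
    iteratedFDeriv ℝ k (fun b => extChartAt 𝓘(ℝ, EG) (h.a 0) (h'.a b)) 0) ∧
  ∀ k ≤ s, iteratedFDeriv ℝ k h.α 0 = iteratedFDeriv ℝ k h'.α 0

variable (n EG G)

/-- The standard fibre of a graded gauge natural bundle `Y → Y₀ → M` of order `(r, s)`: a manifold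
`Z` (the standard fibre of `Y₀`) and a graded vector bundle `⊕ᵢ V i → Z` of finite rank, with
smooth actions (`rho` and, fibrewise linear, `lin`) of the Lie group `W^{r,s}_n G`. The fibre
coordinates of `V i` have degree `deg i ≠ 0`; coordinates of degree `0` belong to `Z`. Smoothness
of the actions is expressed by smooth families of representatives. -/
structure GaugeFibre [LieGroup 𝓘(ℝ, EG) ∞ G] (r s : ℕ) where
  order_le : r ≤ s
  EZ : Type x
  Z : Type x
  ι : Type
  deg : ι → ℤ
  deg_ne_zero : ∀ i, deg i ≠ 0
  F : ι → Type x
  V : ι → Z → Type x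
  [normedEZ : NormedAddCommGroup EZ]
  [spaceEZ : NormedSpace ℝ EZ]
  [finEZ : FiniteDimensional ℝ EZ]
  [topZ : TopologicalSpace Z]
  [chartedZ : ChartedSpace EZ Z]
  [mfdZ : IsManifold 𝓘(ℝ, EZ) ∞ Z]
  [t2Z : T2Space Z]
  [countableZ : SecondCountableTopology Z]
  [finι : Fintype ι]
  [normedF : ∀ i, NormedAddCommGroup (F i)]
  [spaceF : ∀ i, NormedSpace ℝ (F i)]
  [finF : ∀ i, FiniteDimensional ℝ (F i)]
  [addV : ∀ i z, AddCommGroup (V i z)]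
  [moduleV : ∀ i z, Module ℝ (V i z)]
  [topV : ∀ i z, TopologicalSpace (V i z)]
  [topTotal : ∀ i, TopologicalSpace (TotalSpace (F i) (V i))]
  [fiberBundle : ∀ i, FiberBundle (F i) (V i)]
  [vectorBundle : ∀ i, VectorBundle ℝ (F i) (V i)]
  [smoothBundle : ∀ i, ContMDiffVectorBundle ∞ (F i) (V i) 𝓘(ℝ, EZ)]
  rho : GaugeGerm n EG G → Z → Z
  rho_one : ∀ z, rho GaugeGerm.one z = z
  rho_mul : ∀ h h' z, rho (h.mul h') z = rho h (rho h' z)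
  rho_jet : ∀ h h', GaugeGerm.JetEq r s h h' → ∀ z, rho h z = rho h' z
  rho_smooth : ∀ (k : ℕ) (h : Euc k → GaugeGerm n EG G),
    ContMDiff (𝓘(ℝ, Euc k).prod 𝓘(ℝ, Euc n)) 𝓘(ℝ, EG) ∞
      (fun q : Euc k × Euc n => (h q.1).a q.2) →
    ContDiff ℝ ∞ (fun q : Euc k × Euc n => (h q.1).α q.2) →
    ContMDiff (𝓘(ℝ, Euc k).prod 𝓘(ℝ, EZ)) 𝓘(ℝ, EZ) ∞ (fun q : Euc k × Z => rho (h q.1) q.2)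
  lin : ∀ (i : ι) (h : GaugeGerm n EG G) (z : Z), V i z →ₗ[ℝ] V i (rho h z)
  lin_one : ∀ i z v,
    (⟨_, lin i GaugeGerm.one z v⟩ : TotalSpace (F i) (V i)) = ⟨z, v⟩
  lin_mul : ∀ i h h' z v,
    (⟨_, lin i (h.mul h') z v⟩ : TotalSpace (F i) (V i)) = ⟨_, lin i h _ (lin i h' z v)⟩
  lin_jet : ∀ i h h', GaugeGerm.JetEq r s h h' → ∀ z v,
    (⟨_, lin i h z v⟩ : TotalSpace (F i) (V i)) = ⟨_, lin i h' z v⟩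
  lin_smooth : ∀ (i : ι) (k : ℕ) (h : Euc k → GaugeGerm n EG G),
    ContMDiff (𝓘(ℝ, Euc k).prod 𝓘(ℝ, Euc n)) 𝓘(ℝ, EG) ∞
      (fun q : Euc k × Euc n => (h q.1).a q.2) →
    ContDiff ℝ ∞ (fun q : Euc k × Euc n => (h q.1).α q.2) →
    ContMDiff (𝓘(ℝ, Euc k).prod (𝓘(ℝ, EZ).prod 𝓘(ℝ, F i))) (𝓘(ℝ, EZ).prod 𝓘(ℝ, F i)) ∞
      (fun q : Euc k × TotalSpace (F i) (V i) =>
        (⟨_, lin i (h q.1) q.2.1 q.2.2⟩ : TotalSpace (F i) (V i)))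

attribute [instance] GaugeFibre.normedEZ GaugeFibre.spaceEZ GaugeFibre.finEZ GaugeFibre.topZ
  GaugeFibre.chartedZ GaugeFibre.mfdZ GaugeFibre.t2Z GaugeFibre.countableZ GaugeFibre.finι
  GaugeFibre.normedF GaugeFibre.spaceF GaugeFibre.finF GaugeFibre.addV GaugeFibre.moduleV
  GaugeFibre.topV GaugeFibre.topTotal GaugeFibre.fiberBundle GaugeFibre.vectorBundle
  GaugeFibre.smoothBundle

end Fibre

section Sections

variable {n : ℕ} {M : Type u} [TopologicalSpace M] [ChartedSpace (Euc n) M]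
  {EG : Type v₁} [NormedAddCommGroup EG] [NormedSpace ℝ EG]
  {G : Type v} [TopologicalSpace G] [ChartedSpace EG G] [Group G] [LieGroup 𝓘(ℝ, EG) ∞ G]
  {EP : Type w₁} [NormedAddCommGroup EP] [NormedSpace ℝ EP]
  {P : Type w} [TopologicalSpace P] [ChartedSpace EP P] [IsManifold 𝓘(ℝ, EP) ∞ P]

/-- The right action of (representatives of) `W^{r,s}_n G` on frames,
`(e · (a, α))(b) = e(α(b)) · a(b)`. -/
def Frame.gauge {B : PrincipalBundle n M EG G EP P} (e : Frame B) (h : GaugeGerm n EG G) :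
    Frame B :=
  ⟨fun b => B.act (e.1 (h.α b)) (h.a b), by
    refine ⟨B.contMDiff_act.comp ((e.2.1.comp h.smooth_α.contMDiff).prodMk h.smooth_a),
      fun b => ?_⟩
    have h1 : MDifferentiableAt 𝓘(ℝ, Euc n) 𝓘(ℝ, Euc n) (fun b => B.proj (e.1 b)) (h.α b) :=
      ((B.contMDiff_proj.comp e.2.1) (h.α b)).mdifferentiableAt (by simp)
    have h2 : MDifferentiableAt 𝓘(ℝ, Euc n) 𝓘(ℝ, Euc n) h.α b :=
      (h.smooth_α.contMDiff b).mdifferentiableAt (by simp)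
    have h3 : (fun b => B.proj (B.act (e.1 (h.α b)) (h.a b))) =
        (fun b => B.proj (e.1 b)) ∘ h.α := funext fun b => B.proj_act _ _
    rw [h3, mfderiv_comp b h1 h2, mfderiv_eq_fderiv]
    exact (e.2.2 (h.α b)).comp (h.étale b)⟩

variable (B : PrincipalBundle n M EG G EP P) {r s : ℕ}
  (Y : GaugeFibre.{v, v₁, x} n EG G r s)

/-- A smooth section of the bundle `Y₀ = W^{r,s} P ×_{W^{r,s}_n G} Z` over `M`, as an equivariant
map from frames to `Z`. -/
structure Field where
  toFun : Frame B → Y.Z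
  equivariant : ∀ (e : Frame B) (h : GaugeGerm n EG G), Y.rho h (toFun (e.gauge h)) = toFun e
  smooth : ∀ e : Frame B, ContMDiff 𝓘(ℝ, Euc n) 𝓘(ℝ, Y.EZ) ∞ (fun a => toFun (e.translate a))

variable {B Y}

theorem total_add {i : Y.ι} {z z' : Y.Z} {c d : Y.V i z} {c' d' : Y.V i z'}
    (h : (⟨z, c⟩ : TotalSpace (Y.F i) (Y.V i)) = ⟨z', c'⟩)
    (h' : (⟨z, d⟩ : TotalSpace (Y.F i) (Y.V i)) = ⟨z', d'⟩) :
    (⟨z, c + d⟩ : TotalSpace (Y.F i) (Y.V i)) = ⟨z', c' + d'⟩ := by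
  obtain rfl : z = z' := congrArg TotalSpace.proj h
  rw [TotalSpace.mk_inj] at h h' ⊢
  rw [h, h']

theorem total_smul {i : Y.ι} {z z' : Y.Z} {c : Y.V i z} {c' : Y.V i z'} (t : ℝ)
    (h : (⟨z, c⟩ : TotalSpace (Y.F i) (Y.V i)) = ⟨z', c'⟩) :
    (⟨z, t • c⟩ : TotalSpace (Y.F i) (Y.V i)) = ⟨z', t • c'⟩ := by
  obtain rfl : z = z' := congrArg TotalSpace.proj h
  rw [TotalSpace.mk_inj] at h ⊢
  rw [h]

theorem total_zero {i : Y.ι} {z z' : Y.Z} (h : z = z') :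
    (⟨z, 0⟩ : TotalSpace (Y.F i) (Y.V i)) = ⟨z', 0⟩ := by
  subst h; rfl

theorem contMDiff_total_add_smul {i : Y.ι} {f : Euc n → Y.Z} (t t' : ℝ) {c d : ∀ a, Y.V i (f a)}
    (hc : ContMDiff 𝓘(ℝ, Euc n) (𝓘(ℝ, Y.EZ).prod 𝓘(ℝ, Y.F i)) ∞
      (fun a => (⟨f a, c a⟩ : TotalSpace (Y.F i) (Y.V i))))
    (hd : ContMDiff 𝓘(ℝ, Euc n) (𝓘(ℝ, Y.EZ).prod 𝓘(ℝ, Y.F i)) ∞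
      (fun a => (⟨f a, d a⟩ : TotalSpace (Y.F i) (Y.V i)))) :
    ContMDiff 𝓘(ℝ, Euc n) (𝓘(ℝ, Y.EZ).prod 𝓘(ℝ, Y.F i)) ∞
      (fun a => (⟨f a, t • c a + t' • d a⟩ : TotalSpace (Y.F i) (Y.V i))) := by
  intro a
  have h1 := contMDiffAt_totalSpace.1 (hc a)
  have h2 := contMDiffAt_totalSpace.1 (hd a)
  refine contMDiffAt_totalSpace.2 ⟨h1.1, ?_⟩
  refine (((contMDiffAt_iff_contDiffAt.1 h1.2).const_smul t).add
    ((contMDiffAt_iff_contDiffAt.1 h2.2).const_smul t')).contMDiffAt.congr_of_eventuallyEq ?_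
  have h3 : ∀ᶠ b in 𝓝 a, f b ∈ (trivializationAt (Y.F i) (Y.V i) (f a)).baseSet :=
    h1.1.continuousAt.eventually_mem
      ((trivializationAt (Y.F i) (Y.V i) (f a)).open_baseSet.mem_nhds
        (mem_baseSet_trivializationAt _ _ _))
  filter_upwards [h3] with b hb
  have h4 := (trivializationAt (Y.F i) (Y.V i) (f a)).linear ℝ hb
  simp [h4.map_add, h4.map_smul]

/-- The smooth sections of the pull-back of the `i`-th component of the graded vector bundle
`Y → Y₀` along a section `φ` of `Y₀`, as equivariant maps from frames. -/
def Sec (φ : Field B Y) (i : Y.ι) : Submodule ℝ (∀ e : Frame B, Y.V i (φ.toFun e)) where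
  carrier := {ψ |
    (∀ (e : Frame B) (h : GaugeGerm n EG G),
      (⟨_, Y.lin i h _ (ψ (e.gauge h))⟩ : TotalSpace (Y.F i) (Y.V i)) = ⟨φ.toFun e, ψ e⟩) ∧
    ∀ e : Frame B, ContMDiff 𝓘(ℝ, Euc n) (𝓘(ℝ, Y.EZ).prod 𝓘(ℝ, Y.F i)) ∞
      (fun a => (⟨φ.toFun (e.translate a), ψ (e.translate a)⟩ : TotalSpace (Y.F i) (Y.V i)))}
  add_mem' := by
    rintro ψ ψ' ⟨h1, h2⟩ ⟨h3, h4⟩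
    refine ⟨fun e h => ?_, fun e => ?_⟩
    · simpa using total_add (h1 e h) (h3 e h)
    · simpa using contMDiff_total_add_smul 1 1 (h2 e) (h4 e)
  zero_mem' := by
    refine ⟨fun e h => ?_, fun e => ?_⟩
    · simpa using total_zero (φ.equivariant e h)
    · exact (contMDiff_zeroSection ℝ (Y.V i)).comp (φ.smooth e)
  smul_mem' := by
    rintro t ψ ⟨h1, h2⟩
    refine ⟨fun e h => ?_, fun e => ?_⟩
    · simpa using total_smul t (h1 e h)
    · simpa using contMDiff_total_add_smul t 0 (h2 e) (h2 e)

/-- The pull-back of a section of `Y₀` by an automorphism of `P`. -/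
def BundleAut.pullField (A : BundleAut B) (φ : Field B Y) : Field B Y where
  toFun := fun e => φ.toFun (A.onFrame e)
  equivariant := fun e h => by
    have : A.onFrame (e.gauge h) = (A.onFrame e).gauge h :=
      Subtype.ext (funext fun b => A.equivariant _ _)
    rw [this, φ.equivariant]
  smooth := fun e => φ.smooth (A.onFrame e)

/-- The pull-back of a section of the graded part by an automorphism of `P`. -/
def BundleAut.pullSec (A : BundleAut B) {φ : Field B Y} {i : Y.ι} (ψ : Sec φ i) :
    Sec (A.pullField φ) i :=
  ⟨fun e => ψ.1 (A.onFrame e), by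
    refine ⟨fun e h => ?_, fun e => ψ.2.2 (A.onFrame e)⟩
    have h1 : A.onFrame (e.gauge h) = (A.onFrame e).gauge h :=
      Subtype.ext (funext fun b => A.equivariant _ _)
    have h2 := ψ.2.1 (A.onFrame e) h
    rw [← h1] at h2
    exact h2⟩

end Sections

/-! ### Graded functions on `Γ(Y)` and local forms of vertical degree zero -/

section Local

variable {n : ℕ} {M : Type u} [TopologicalSpace M] [ChartedSpace (Euc n) M]
  {EG : Type v₁} [NormedAddCommGroup EG] [NormedSpace ℝ EG]
  {G : Type v} [TopologicalSpace G] [ChartedSpace EG G] [Group G] [LieGroup 𝓘(ℝ, EG) ∞ G]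
  {EP : Type w₁} [NormedAddCommGroup EP] [NormedSpace ℝ EP]
  {P : Type w} [TopologicalSpace P] [ChartedSpace EP P] [IsManifold 𝓘(ℝ, EP) ∞ P]
  (B : PrincipalBundle n M EG G EP P) {r s : ℕ}
  (Y : GaugeFibre.{v, v₁, x} n EG G r s)

/-- Families of maps on the graded vector bundle `Γ(Y) → Γ(Y₀)`: `f φ k j ψ` is the coefficient, at
the section `φ` of `Y₀`, of the component of polynomial degree `k` in the fibre coordinates,
evaluated on sections `ψ a` of the components `j a` of `φ^* Y`. In other words, if `θ₁, …, θₖ` are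
formal parameters whose degrees make `∑ θₐ ψₐ` a field of degree zero, it is the coefficient of
`θ₁ ⋯ θₖ` in the value of `f` at `φ + ∑ θₐ ψₐ`. -/
abbrev GMap (R : Type*) := ∀ (φ : Field B Y) (k : ℕ) (j : Fin k → Y.ι), (∀ a, Sec φ (j a)) → R

variable {B Y}

/-- All components are multilinear. -/
def IsMultilinear {R : Type*} [AddCommGroup R] [Module ℝ R] (f : GMap B Y R) : Prop :=
  ∀ (φ : Field B Y) (k : ℕ) (j : Fin k → Y.ι),
    ∃ L : MultilinearMap ℝ (fun a => Sec φ (j a)) R, ∀ ψ, f φ k j ψ = L ψ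

/-- The sign `(-1)^{ab}`. -/
def koszul (a b : ℤ) : ℝ := if Odd a ∧ Odd b then -1 else 1

/-- All components are graded symmetric: exchanging two neighbouring arguments of degrees `a`, `b`
gives the sign `(-1)^{ab}`. -/
def IsGradedSymm {R : Type*} [AddCommGroup R] [Module ℝ R] (f : GMap B Y R) : Prop :=
  ∀ (φ : Field B Y) (k : ℕ) (j : Fin k → Y.ι) (ψ : ∀ a, Sec φ (j a)) (a b : Fin k),
    (a : ℕ) + 1 = b →
    f φ k (fun c => j (Equiv.swap a b c)) (fun c => ψ (Equiv.swap a b c)) =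
      koszul (Y.deg (j a)) (Y.deg (j b)) • f φ k j ψ

/-- `f` is homogeneous of ghost number `d`. -/
def IsGhost {R : Type*} [Zero R] (d : ℤ) (f : GMap B Y R) : Prop :=
  ∀ (φ : Field B Y) (k : ℕ) (j : Fin k → Y.ι) (ψ : ∀ a, Sec φ (j a)),
    ∑ a, Y.deg (j a) ≠ d → f φ k j ψ = 0

/-- The sign obtained by reordering graded variables of degrees `d` from the order "first those in
`S`, then the others" to the natural order. -/
def shuffleSign {k : ℕ} (d : Fin k → ℤ) (S : Finset (Fin k)) : ℝ :=
  ∏ a ∈ Sᶜ, ∏ b ∈ S, if a < b then koszul (d a) (d b) else 1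

/-- The product of graded functions on `Γ(Y)`. -/
def GMap.mul (f g : GMap B Y ℝ) : GMap B Y ℝ := fun φ k j ψ =>
  ∑ S : Finset (Fin k), shuffleSign (fun a => Y.deg (j a)) S *
    f φ S.card (fun a => j (S.orderEmbOfFin rfl a)) (fun a => ψ (S.orderEmbOfFin rfl a)) *
    g φ Sᶜ.card (fun a => j (Sᶜ.orderEmbOfFin rfl a)) (fun a => ψ (Sᶜ.orderEmbOfFin rfl a))

/-- Coordinates on the space of `l`-jets at a point of maps `ℝⁿ → A`. -/
abbrev JetSpace (n l : ℕ) (A : Type*) [NormedAddCommGroup A] [NormedSpace ℝ A] :=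
  ∀ m : Fin (l + 1), ContinuousMultilinearMap ℝ (fun _ : Fin m => Euc n) A

/-- The `l`-jet of `g` at `a`. -/
def jet {A : Type*} [NormedAddCommGroup A] [NormedSpace ℝ A] (l : ℕ) (g : Euc n → A) (a : Euc n) :
    JetSpace n l A :=
  fun m => iteratedFDeriv ℝ m g a

/-- The coordinate expression of a section `φ` of `Y₀` in the frame `e` and in the preferred chart
of `Z` at `z`. -/
def Field.rep (φ : Field B Y) (e : Frame B) (z : Y.Z) : Euc n → Y.EZ := fun a =>
  extChartAt 𝓘(ℝ, Y.EZ) z (φ.toFun (e.translate a))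

/-- The coordinate expression of a section `ψ` of `φ^* Y` in the frame `e` and in the preferred
local trivialization over `Z` at `z`. -/
def secRep {φ : Field B Y} {i : Y.ι} (ψ : Sec φ i) (e : Frame B) (z : Y.Z) : Euc n → Y.F i :=
  fun a => (trivializationAt (Y.F i) (Y.V i) z
    ⟨φ.toFun (e.translate a), ψ.1 (e.translate a)⟩).2

/-- The section `φ`, near the point with coordinate `a` of the frame `e`, takes values in the
domains of the preferred chart and of the preferred local trivializations at `z`. -/
def Field.InDomain (φ : Field B Y) (e : Frame B) (z : Y.Z) (a : Euc n) : Prop :=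
  φ.toFun (e.translate a) ∈ (chartAt Y.EZ z).source ∧
  ∀ i, φ.toFun (e.translate a) ∈ (trivializationAt (Y.F i) (Y.V i) z).baseSet

/-- Locality: near every point of `M × Γ(Y₀)` (a point of `M` being the base point of a frame `e`),
the form is in coordinates a smooth function of the base point and of the `l`-jets of the fields,
for some finite `l`, and polynomial, of degree at most some `K`, in the jets of the graded fields.
(The dependence on each jet of `ψ` is linear when `f` is multilinear.) -/
def IsLocal {p : ℕ} (f : GMap B Y (Form n M p)) : Prop :=
  ∀ (e : Frame B) (φ₀ : Field B Y), ∃ (l K : ℕ) (U : Set (Euc n × JetSpace n l Y.EZ)),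
    IsOpen U ∧ ((0, jet l (φ₀.rep e (φ₀.toFun e)) 0) : Euc n × JetSpace n l Y.EZ) ∈ U ∧
    ∀ (k : ℕ) (j : Fin k → Y.ι),
      ∃ H : (Euc n × JetSpace n l Y.EZ) × (∀ a, JetSpace n l (Y.F (j a))) →
          Euc n [⋀^Fin p]→L[ℝ] ℝ,
        ContDiffOn ℝ ∞ H (U ×ˢ univ) ∧
        ∀ (φ : Field B Y) (ψ : ∀ a, Sec φ (j a)) (a : Euc n),
          φ.InDomain e (φ₀.toFun e) a →
          (a, jet l (φ.rep e (φ₀.toFun e)) a) ∈ U →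
          (f φ k j ψ (e.base a)).compContinuousLinearMap
              (mfderiv 𝓘(ℝ, Euc n) 𝓘(ℝ, Euc n) e.base a) =
            H ((a, jet l (φ.rep e (φ₀.toFun e)) a),
              fun c => jet l (secRep (ψ c) e (φ₀.toFun e)) a) ∧
          (K < k → f φ k j ψ (e.base a) = 0)

/-- Truncation of jets. -/
def JetSpace.trunc {A : Type*} [NormedAddCommGroup A] [NormedSpace ℝ A] {l l' : ℕ} (hl : l ≤ l')
    (J : JetSpace n l' A) : JetSpace n l A :=
  fun m => J (Fin.castLE (Nat.succ_le_succ hl) m)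

theorem JetSpace.contDiff_trunc {A : Type*} [NormedAddCommGroup A] [NormedSpace ℝ A] {l l' : ℕ}
    (hl : l ≤ l') : ContDiff ℝ ∞ (JetSpace.trunc (n := n) (A := A) hl) :=
  contDiff_pi.2 fun m =>
    (ContinuousLinearMap.proj (R := ℝ) (φ := fun m : Fin (l' + 1) =>
      ContinuousMultilinearMap ℝ (fun _ : Fin m => Euc n) A)
      (Fin.castLE (Nat.succ_le_succ hl) m)).contDiff

set_option linter.unusedSectionVars false in
theorem IsLocal.smul_add {p : ℕ} {f g : GMap B Y (Form n M p)} (t : ℝ) (hf : IsLocal f)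
    (hg : IsLocal g) : IsLocal (t • f + g) := by
  intro e φ₀
  obtain ⟨l, K, U, hU, hmU, h⟩ := hf e φ₀
  obtain ⟨l', K', U', hU', hmU', h'⟩ := hg e φ₀
  let L := max l l'
  have hl : l ≤ L := le_max_left _ _
  have hl' : l' ≤ L := le_max_right _ _
  let T : Euc n × JetSpace n L Y.EZ → Euc n × JetSpace n l Y.EZ :=
    fun q => (q.1, JetSpace.trunc hl q.2)
  let T' : Euc n × JetSpace n L Y.EZ → Euc n × JetSpace n l' Y.EZ :=
    fun q => (q.1, JetSpace.trunc hl' q.2)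
  have hT : ContDiff ℝ ∞ T :=
    contDiff_fst.prodMk ((JetSpace.contDiff_trunc hl).comp contDiff_snd)
  have hT' : ContDiff ℝ ∞ T' :=
    contDiff_fst.prodMk ((JetSpace.contDiff_trunc hl').comp contDiff_snd)
  refine ⟨L, max K K', T ⁻¹' U ∩ T' ⁻¹' U',
    (hU.preimage hT.continuous).inter (hU'.preimage hT'.continuous), ⟨hmU, hmU'⟩, fun k j => ?_⟩
  obtain ⟨H, hH, hf'⟩ := h k j
  obtain ⟨H', hH', hg'⟩ := h' k j
  have key : ∀ {l₁ : ℕ} (hl₁ : l₁ ≤ L), ContDiff ℝ ∞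
      (fun q : (Euc n × JetSpace n L Y.EZ) × (∀ a, JetSpace n L (Y.F (j a))) =>
        (((q.1.1, JetSpace.trunc hl₁ q.1.2), fun a => JetSpace.trunc hl₁ (q.2 a)) :
          (Euc n × JetSpace n l₁ Y.EZ) × (∀ a, JetSpace n l₁ (Y.F (j a))))) := by
    intro l₁ hl₁
    refine ((contDiff_fst.comp contDiff_fst).prodMk
      ((JetSpace.contDiff_trunc hl₁).comp (contDiff_snd.comp contDiff_fst))).prodMk ?_
    exact contDiff_pi.2 fun a => (JetSpace.contDiff_trunc hl₁).comp
      ((ContinuousLinearMap.proj (R := ℝ) (φ := fun a => JetSpace n L (Y.F (j a))) a).contDiff.comp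
        contDiff_snd)
  refine ⟨fun q => t • H ((q.1.1, JetSpace.trunc hl q.1.2), fun a => JetSpace.trunc hl (q.2 a)) +
    H' ((q.1.1, JetSpace.trunc hl' q.1.2), fun a => JetSpace.trunc hl' (q.2 a)), ?_, ?_⟩
  · refine ContDiffOn.add (ContDiffOn.const_smul t (hH.comp (key hl).contDiffOn ?_))
      (hH'.comp (key hl').contDiffOn ?_)
    · rintro q ⟨⟨h1, -⟩, -⟩; exact ⟨h1, mem_univ _⟩
    · rintro q ⟨⟨-, h1⟩, -⟩; exact ⟨h1, mem_univ _⟩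
  · rintro φ ψ a hd ⟨h1, h2⟩
    obtain ⟨h3, h4⟩ := hf' φ ψ a hd h1
    obtain ⟨h5, h6⟩ := hg' φ ψ a hd h2
    refine ⟨?_, fun hk => ?_⟩
    · refine Eq.trans ?_ (congrArg₂ (fun y z => t • y + z) h3 h5)
      ext v
      rfl
    · change t • f φ k j ψ (e.base a) + g φ k j ψ (e.base a) = 0
      rw [h4 (lt_of_le_of_lt (le_max_left _ _) hk), h6 (lt_of_le_of_lt (le_max_right _ _) hk)]
      simp

set_option linter.unusedSectionVars false in
theorem isLocal_zero {p : ℕ} : IsLocal (0 : GMap B Y (Form n M p)) := by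
  intro e φ₀
  refine ⟨0, 0, univ, isOpen_univ, mem_univ _, fun k j => ⟨fun _ => 0, contDiffOn_const, ?_⟩⟩
  intro φ ψ a _ _
  refine ⟨?_, fun _ => rfl⟩
  ext v
  rfl

variable (B Y)

/-- The space `Ω_loc^{p,0}` of local forms of horizontal degree `p` and vertical degree `0`. -/
def LocForm (p : ℕ) : Submodule ℝ (GMap B Y (Form n M p)) where
  carrier := {f | IsMultilinear f ∧ IsGradedSymm f ∧ IsLocal f}
  add_mem' := by
    rintro f g ⟨h1, h2, h3⟩ ⟨h4, h5, h6⟩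
    refine ⟨fun φ k j => ?_, fun φ k j ψ a b hab => ?_, ?_⟩
    · obtain ⟨L, hL⟩ := h1 φ k j
      obtain ⟨L', hL'⟩ := h4 φ k j
      exact ⟨L + L', fun ψ => congrArg₂ (· + ·) (hL ψ) (hL' ψ)⟩
    · have := congrArg₂ (· + ·) (h2 φ k j ψ a b hab) (h5 φ k j ψ a b hab)
      exact this.trans (smul_add _ _ _).symm
    · simpa using h3.smul_add 1 h6
  zero_mem' := ⟨fun _ _ _ => ⟨0, fun _ => rfl⟩, fun _ _ _ _ _ _ _ => (smul_zero _).symm,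
    isLocal_zero⟩
  smul_mem' := by
    rintro t f ⟨h1, h2, h3⟩
    refine ⟨fun φ k j => ?_, fun φ k j ψ a b hab => ?_, ?_⟩
    · obtain ⟨L, hL⟩ := h1 φ k j
      exact ⟨t • L, fun ψ => congrArg (t • ·) (hL ψ)⟩
    · have := congrArg (t • ·) (h2 φ k j ψ a b hab)
      exact this.trans (smul_comm _ _ _)
    · simpa using h3.smul_add t isLocal_zero

variable {B Y}

/-- The horizontal differential: the de Rham differential of `M`, at fixed fields. -/
def GMap.dh {p : ℕ} (f : GMap B Y (Form n M p)) : GMap B Y (Form n M (p + 1)) :=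
  fun φ k j ψ => (f φ k j ψ).d

/-- The value of a form of horizontal degree `p` at a point `y` of `M` and tangent vectors `v` of
`M` at `y`, as a graded function on `Γ(Y)`. -/
def GMap.evalAt {p : ℕ} (f : GMap B Y (Form n M p)) (y : M)
    (v : Fin p → TangentSpace 𝓘(ℝ, Euc n) y) : GMap B Y ℝ :=
  fun φ k j ψ => f φ k j ψ y v

/-- The integral `Φ ↦ ∫_γ f(·, Φ)`, as a graded function on `Γ(Y)`. -/
def GMap.int {p : ℕ} (f : GMap B Y (Form n M p)) (γ : Submfd n M p) : GMap B Y ℝ :=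
  fun φ k j ψ => γ.integrate (f φ k j ψ)

/-- The restriction of `f` to `γ` has compact support along `γ` (uniformly in the fields). -/
def GMap.CompactAlong {p : ℕ} (f : GMap B Y (Form n M p)) (γ : Submfd n M p) : Prop :=
  ∃ C : Set γ.carrier, IsCompact C ∧ ∀ (φ : Field B Y) (k : ℕ) (j : Fin k → Y.ι)
    (ψ : ∀ a, Sec φ (j a)), ∀ y : γ.carrier, y ∉ C → Form.pullback (m := p) γ.incl (f φ k j ψ) y = 0

variable (B Y)

/-- `Loc(Γ(Y))`: the space of functions on `Γ(Y)` spanned by integrals of local forms over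
submanifolds of `M`. (For points of `M` these are the values of local functions.) -/
def Loc : Submodule ℝ (GMap B Y ℝ) :=
  Submodule.span ℝ {F | ∃ (p : ℕ) (γ : Submfd n M p) (f : LocForm B Y p),
    f.1.CompactAlong γ ∧ F = f.1.int γ}

/-- A vertical local vector field of degree `d` over `M × Γ(Y)`: a vector field on the graded
manifold `Γ(Y)`, i.e. a graded derivation `act` of functions on `Γ(Y)`, that is local, i.e. maps
local forms to local forms when it acts on `M × Γ(Y)` in the direction of `Γ(Y)`. The resulting Lie
derivative of local forms is `lie`. The action on functions given by integrals over `M` is by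
differentiation of the integrand. -/
structure VertField (d : ℤ) where
  act : Loc B Y →ₗ[ℝ] Loc B Y
  lie : ∀ p : ℕ, LocForm B Y p →ₗ[ℝ] LocForm B Y p
  act_evalAt : ∀ (p : ℕ) (f : LocForm B Y p) (y : M) (v : Fin p → TangentSpace 𝓘(ℝ, Euc n) y)
    (F : Loc B Y), F.1 = f.1.evalAt y v → (act F).1 = (lie p f).1.evalAt y v
  act_int : ∀ (p : ℕ) (f : LocForm B Y p) (γ : Submfd n M p), f.1.CompactAlong γ →
    ∀ F : Loc B Y, F.1 = f.1.int γ → (act F).1 = (lie p f).1.int γ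
  degree : ∀ (c : ℤ) (F : Loc B Y), IsGhost c F.1 → IsGhost (c + d) (act F).1
  leibniz : ∀ (c : ℤ) (F F' H : Loc B Y), IsGhost c F.1 → H.1 = F.1.mul F'.1 →
    (act H).1 = (act F).1.mul F'.1 + koszul d c • F.1.mul (act F').1

variable {B Y}

/-- The fields `(φ, ψ)` and `(φ', ψ')` agree over `U ⊆ M`. -/
def AgreeOver (U : Set M) {k : ℕ} {j : Fin k → Y.ι} {φ φ' : Field B Y}
    (ψ : ∀ a, Sec φ (j a)) (ψ' : ∀ a, Sec φ' (j a)) : Prop :=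
  ∀ e : Frame B, e.base 0 ∈ U → φ.toFun e = φ'.toFun e ∧ ∀ a,
    (⟨φ.toFun e, (ψ a).1 e⟩ : TotalSpace (Y.F (j a)) (Y.V (j a))) = ⟨φ'.toFun e, (ψ' a).1 e⟩

/-- The function `F` on `Γ(Y)` depends only on the restriction of the fields to `U ⊆ M`. -/
def GMap.DependsOnlyOver (F : GMap B Y ℝ) (U : Set M) : Prop :=
  ∀ (φ φ' : Field B Y) (k : ℕ) (j : Fin k → Y.ι) (ψ : ∀ a, Sec φ (j a)) (ψ' : ∀ a, Sec φ' (j a)),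
    AgreeOver U ψ ψ' → F φ k j ψ = F φ' k j ψ'

/-- `D` is the vertical local vector field `ξ_Ξ` on `Γ(Y)` induced by the canonical action of
`Aut(P)`, i.e. its value at a field is the Lie derivative of the field along `Ξ`: the function
`D F` is the derivative of `F` along the pull-backs of fields by automorphisms with initial
velocity `Ξ`. (The velocity only matters where `F` depends on the fields; in this way no flow of
`Ξ` has to exist for all times.) -/
def VertField.IsCanonical (D : VertField B Y 0) (Ξ : InvField B) : Prop :=
  ∀ (F : Loc B Y) (U : Set M), IsOpen U → F.1.DependsOnlyOver U →
    ∀ A : AutCurve B, A.HasVelocityOver Ξ U →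
      ∀ (φ : Field B Y) (k : ℕ) (j : Fin k → Y.ι) (ψ : ∀ a, Sec φ (j a)),
        HasDerivAt
          (fun t : ℝ => F.1 ((A.toFun t).pullField φ) k j (fun a => (A.toFun t).pullSec (ψ a)))
          ((D.act F).1 φ k j ψ) 0

/-- The graded commutator `[D, D'] = D D' - (-1)^{d d'} D' D`, acting on functions on `Γ(Y)`. -/
def VertField.bracket {d d' : ℤ} (D : VertField B Y d) (D' : VertField B Y d') :
    Loc B Y →ₗ[ℝ] Loc B Y :=
  D.act ∘ₗ D'.act - koszul d d' • (D'.act ∘ₗ D.act)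

variable (B Y)

/-- A `QKG^⋆`-structure on `M × Γ(Y)`; for the trivial structure group this is a
`QK^⋆`-structure. In `xi_K` the bracket of `Ξ₁, Ξ₂` is that of
the Lie algebra of the group `Aut(P)`, which is minus the bracket of vector fields on `P`; with it
the map `Ξ ↦ ξ_Ξ` (Lie derivative of fields along `Ξ`) preserves brackets. -/
structure QKGStructure where
  Q : VertField B Y 1
  K : InvField B → VertField B Y (-1)
  xi : InvField B → VertField B Y 0
  xi_canonical : ∀ Ξ, (xi Ξ).IsCanonical Ξ
  Q_Q : Q.act ∘ₗ Q.act = 0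
  K_linear : ∀ (t : ℝ) (Ξ₁ Ξ₂ Ξ : InvField B), (∀ q, Ξ.toFun q = t • Ξ₁.toFun q + Ξ₂.toFun q) →
    (K Ξ).act = t • (K Ξ₁).act + (K Ξ₂).act
  K_K : ∀ Ξ₁ Ξ₂, (K Ξ₁).bracket (K Ξ₂) = 0
  xi_K : ∀ Ξ₁ Ξ₂ Ξ : InvField B,
    (∀ q, Ξ.toFun q = -VectorField.mlieBracket 𝓘(ℝ, EP) Ξ₁.toFun Ξ₂.toFun q) →
    (xi Ξ₁).bracket (K Ξ₂) = (K Ξ).act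
  Q_K : ∀ Ξ, Q.bracket (K Ξ) = (xi Ξ).act

/-- A deformed `QKG^⋆`-structure: a `QKG^⋆`-structure with a deformation `K_Ξ ↦ K_Ξ + t K'_Ξ`,
where `[Q, K'_Ξ] = 0` and `[K'_Ξ₁, K'_Ξ₂] = 0`. The deformed fields are called `Kt`. (The
undeformed case is `K' = 0` or `t = 0`.) -/
structure DeformedQKG extends QKGStructure B Y where
  K' : InvField B → VertField B Y (-1)
  Q_K' : ∀ Ξ, Q.bracket (K' Ξ) = 0
  K'_K' : ∀ Ξ₁ Ξ₂, (K' Ξ₁).bracket (K' Ξ₂) = 0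
  t : ℝ
  Kt : InvField B → VertField B Y (-1)
  Kt_act : ∀ Ξ, (Kt Ξ).act = (K Ξ).act + t • (K' Ξ).act
  Kt_lie : ∀ (Ξ : InvField B) (p : ℕ) (f : LocForm B Y p),
    ((Kt Ξ).lie p f).1 = ((K Ξ).lie p f).1 + t • ((K' Ξ).lie p f).1

variable {B Y}

/-- `f` is `d_h`-exact; a form of horizontal degree `0` is so only if it vanishes. -/
def IsDhExact : ∀ {p : ℕ}, GMap B Y (Form n M p) → Prop
  | 0, f => f = 0
  | p + 1, f => ∃ f' : LocForm B Y p, f = f'.1.dh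

/-- `f` is the horizontal differential of a local form of ghost number `d`. -/
def IsDhExactGhost (d : ℤ) : ∀ {p : ℕ}, GMap B Y (Form n M p) → Prop
  | 0, f => f = 0
  | p + 1, f => ∃ f' : LocForm B Y p, IsGhost d f'.1 ∧ f = f'.1.dh

/-- The vertical local vector field `D`, of degree `d`, is a Noether symmetry of the Lagrangian
`L` (of ghost number `0`): its Lie derivative is `d_h α`, with `α` of degree `(n - 1, 0, d)`. -/
def VertField.IsNoether {d : ℤ} (D : VertField B Y d) (L : LocForm B Y n) : Prop :=
  IsDhExactGhost d (D.lie n L).1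

variable (B Y)

/-- A Lagrangian field theory with a deformed `QKG^⋆`-structure for which `Q` is a Noether
symmetry. The Lagrangian is a local form of degree `(n, 0, 0)` with compact support along `M`. With
trivial structure group (and `P = M`) this is a cohomological Lagrangian field theory (CohLFT). -/
structure CohTheory extends DeformedQKG B Y where
  lagrangian : LocForm B Y n
  ghost_lagrangian : IsGhost 0 lagrangian.1
  compact_lagrangian : ∃ C : Set M, IsCompact C ∧ ∀ (φ : Field B Y) (k : ℕ) (j : Fin k → Y.ι)
    (ψ : ∀ a, Sec φ (j a)), ∀ y ∉ C, lagrangian.1 φ k j ψ y = 0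
  Q_noether : Q.IsNoether lagrangian

/-- A cohomological Lagrangian gauge field theory (CohLGFT): moreover `I_λ` and `δ_λ`, i.e. `K_Ξ`
and `ξ_Ξ` for vertical `Ξ`, are Noether symmetries. -/
structure CohGaugeTheory extends CohTheory B Y where
  I_noether : ∀ Ξ : InvField B, Ξ.IsVertical → (Kt Ξ).IsNoether lagrangian
  δ_noether : ∀ Ξ : InvField B, Ξ.IsVertical → (xi Ξ).IsNoether lagrangian

variable {B Y}

/-- Preobservables of a CohLFT: local forms that are `Q`-closed up to a `d_h`-exact term. -/
def CohTheory.IsPreobservable (T : CohTheory B Y) {p : ℕ} (O : LocForm B Y p) : Prop :=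
  IsDhExact (T.Q.lie p O).1

/-- Preobservables of a CohLGFT are in addition basic with respect to `Gau(P)^⋆`. -/
def CohGaugeTheory.IsPreobservable (T : CohGaugeTheory B Y) {p : ℕ} (O : LocForm B Y p) : Prop :=
  T.toCohTheory.IsPreobservable O ∧
  ∀ Ξ : InvField B, Ξ.IsVertical → ((T.Kt Ξ).lie p O).1 = 0 ∧ ((T.xi Ξ).lie p O).1 = 0

/-- The functional `∫_γ f` satisfies `ξ_Ξ (∫_γ f) = Q (∫_γ K_Ξ f)`, an equality of functions on
`Γ(Y)`. -/
def CohTheory.InvariantUpToQExact (T : CohTheory B Y) {p : ℕ} (γ : Submfd n M p)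
    (f : LocForm B Y p) (Ξ : InvField B) : Prop :=
  ∃ F H : Loc B Y, F.1 = f.1.int γ ∧ H.1 = ((T.Kt Ξ).lie p f).1.int γ ∧
    (T.xi Ξ).act F = T.Q.act H

end Local

/-- The trivial group is a Lie group (of dimension `0`). -/
instance : LieGroup 𝓘(ℝ, PUnit.{1}) ∞ PUnit.{1} where
  contMDiff_mul := contMDiff_const (c := PUnit.unit)
  contMDiff_inv := contMDiff_const (c := PUnit.unit)

/-- A smooth vector field on `M`, as an invariant vector field of the trivial bundle `M → M`. -/
def InvField.ofVectorField {n : ℕ} {M : Type u} [TopologicalSpace M] [ChartedSpace (Euc n) M]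
    [IsManifold 𝓘(ℝ, Euc n) ∞ M] (X : ∀ y : M, TangentSpace 𝓘(ℝ, Euc n) y)
    (hX : ContMDiff 𝓘(ℝ, Euc n) 𝓘(ℝ, Euc n).tangent ∞
      (fun y => (⟨y, X y⟩ : TangentBundle 𝓘(ℝ, Euc n) M))) : InvField (trivialBundle n M) where
  toFun := X
  smooth := hX
  invariant := fun _ q => by
    change mfderiv 𝓘(ℝ, Euc n) 𝓘(ℝ, Euc n) id q (X q) = X q
    rw [mfderiv_id]
    rfl

end CohLFT

end

/-!
The theorem is a homotopy formula combined with Stokes' theorem. Since `[Q, K_Ξ] = ξ_Ξ`, also for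
the deformed `K_Ξ`, and vertical local vector fields act on `∫_γ f` by acting on `f`,
`ξ_Ξ ∫_γ f = Q ∫_γ K_Ξ f + K_Ξ ∫_γ Q f`
(`DeformedQKG.xi_act_eq`, `CohTheory.invariantUpToQExact_of_int_eq_zero`). It remains to see that
`∫_γ Q f = 0` when `Q f = d_h α`.

* At fixed fields, `α` is a smooth form on `M`: locality says that its pull-back along a frame is a
  smooth function of jets of smooth maps, and there is a frame at every point (`IsLocal.smoothAt`,
  `exists_frame`). The exterior derivative commutes with the restriction of `α` to `γ`
  (`Form.SmoothAt.d_pullback`), so Stokes' theorem (`integral_d_eq_zero`) settles the case of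
  compact `γ`. It is proved by splitting the form with the partition of unity that also defines the
  integral, changing charts so that each piece is integrated in one chart, and integrating the
  coordinate formula for the exterior derivative over `ℝᵖ⁺¹`.
* For the action, `M` need not be compact. The form `Q L` has compact support, because `Q` does not
  enlarge supports (`VertField.lie_eq_zero`), but `α` need not have. For a general form this would
  break Stokes' theorem. Here `α` has ghost number `1`, so its non-zero components are linear in
  at least one graded field. Cutting this field off outside a neighbourhood of the support of `Q L`
  changes neither `d_h α` near this support nor, therefore, the integral, and it makes `α` compactly
  supported, since `α` depends on germs of fields only (`IsDhExactGhost.int_eq_zero`).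
-/

namespace CohLFT

/-! ### Differential forms on vector spaces -/

section Flat

variable {n m p : ℕ}

/-- A family of alternating forms is smooth as soon as its values on fixed vectors are: evaluation
on tuples of basis vectors embeds the alternating forms into a finite-dimensional space. -/
theorem contDiffAt_alternating_of_apply {E : Type*} [NormedAddCommGroup E] [NormedSpace ℝ E]
    {f : E → Euc n [⋀^Fin p]→L[ℝ] ℝ} {x : E}
    (h : ∀ v, ContDiffAt ℝ ∞ (fun a => f a v) x) : ContDiffAt ℝ ∞ f x := by
  let ev : (Euc n [⋀^Fin p]→L[ℝ] ℝ) →ₗ[ℝ] ((Fin p → Fin n) → ℝ) :=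
    { toFun := fun A r => A (fun i => EuclideanSpace.basisFun (Fin n) ℝ (r i))
      map_add' := fun _ _ => rfl
      map_smul' := fun _ _ => rfl }
  have hev : LinearMap.ker ev = ⊥ := by
    refine LinearMap.ker_eq_bot'.2 fun A hA => ?_
    have h0 : A.toAlternatingMap = 0 :=
      Module.Basis.ext_alternating (EuclideanSpace.basisFun (Fin n) ℝ).toBasis fun r _ => by
        simpa [ev] using congrFun hA r
    ext v
    exact congrArg (fun B : Euc n [⋀^Fin p]→ₗ[ℝ] ℝ => B v) h0
  obtain ⟨L, hL⟩ := ev.exists_leftInverse_of_injective hev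
  have h1 : f = fun a => LinearMap.toContinuousLinearMap L (ev (f a)) :=
    funext fun a => (LinearMap.congr_fun hL (f a)).symm
  rw [h1]
  exact (LinearMap.toContinuousLinearMap L).contDiff.contDiffAt.comp x
    (contDiffAt_pi.2 fun r => h _)

theorem contDiffAt_compContinuousLinearMap {E : Type*} [NormedAddCommGroup E] [NormedSpace ℝ E]
    {η : E → Euc n [⋀^Fin p]→L[ℝ] ℝ} {D : E → Euc m →L[ℝ] Euc n} {x : E}
    (hη : ContDiffAt ℝ ∞ η x) (hD : ContDiffAt ℝ ∞ D x) :
    ContDiffAt ℝ ∞ (fun a => (η a).compContinuousLinearMap (D a)) x := by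
  refine contDiffAt_alternating_of_apply fun v => ?_
  have h1 : ContDiffAt ℝ ∞ (fun a =>
      ContinuousMultilinearMap.compContinuousLinearMapContinuousMultilinear ℝ
        (fun _ : Fin p => Euc m) (fun _ : Fin p => Euc n) ℝ (fun _ => D a)) x :=
    (ContinuousMultilinearMap.contDiff _).contDiffAt.comp x (contDiffAt_pi.2 fun _ => hD)
  have h2 : ContDiffAt ℝ ∞ (fun a =>
      ContinuousAlternatingMap.toContinuousMultilinearMapCLM ℝ (η a)) x :=
    (ContinuousLinearMap.contDiff _).contDiffAt.comp x hη
  exact (ContinuousMultilinearMap.apply ℝ (fun _ : Fin p => Euc m) ℝ v).contDiff.contDiffAt.comp x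
    (h1.clm_apply h2)

/-- Stokes' theorem on `ℝᵖ⁺¹` for compactly supported forms: each term of the coordinate formula
for `dη` is a partial derivative of a compactly supported function. -/
theorem integral_extDeriv_eq_zero {η : Euc (p + 1) → Euc (p + 1) [⋀^Fin p]→L[ℝ] ℝ}
    (hη : ContDiff ℝ ∞ η) (hc : HasCompactSupport η) (v : Fin (p + 1) → Euc (p + 1)) :
    ∫ a, extDeriv η a v = 0 := by
  have hd : Differentiable ℝ η := hη.differentiable (by simp)
  have h1 : ∀ u : Fin p → Euc (p + 1), ContDiff ℝ ∞ (fun a => η a u) := fun u =>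
    (ContinuousAlternatingMap.apply ℝ (Euc (p + 1)) ℝ u).contDiff.comp hη
  have h2 : ∀ u : Fin p → Euc (p + 1), HasCompactSupport (fun a => η a u) := fun u =>
    hc.comp_left (g := fun A : Euc (p + 1) [⋀^Fin p]→L[ℝ] ℝ => A u) rfl
  have h3 : ∀ (u : Fin p → Euc (p + 1)) (w : Euc (p + 1)),
      Integrable (fun a => fderiv ℝ (fun b => η b u) a w) := fun u w =>
    (((h1 u).continuous_fderiv
      (by simp)).clm_apply continuous_const).integrable_of_hasCompactSupport
      (((h2 u).fderiv ℝ).comp_left (g := fun A : Euc (p + 1) →L[ℝ] ℝ => A w) rfl)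
  have h4 : ∀ (u : Fin p → Euc (p + 1)) (w : Euc (p + 1)),
      ∫ a, fderiv ℝ (fun b => η b u) a w = 0 := fun u w => by
    -- Integration by parts against the constant function `1`.
    have := integral_mul_fderiv_eq_neg_fderiv_mul_of_integrable (μ := volume)
      (f := fun _ : Euc (p + 1) => (1 : ℝ)) (g := fun a => η a u) (v := w)
      (by simp) (by simpa using h3 u w)
      (by simpa using (h1 u).continuous.integrable_of_hasCompactSupport (h2 u))
      (fun _ _ => differentiableAt_const _)
      (fun a _ => (h1 u).differentiable (by simp) a)
    simpa using this
  simp_rw [fun a => extDeriv_apply (hd a) v]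
  rw [integral_finsetSum]
  · simp [integral_const_mul, h4]
  · intro i _
    simpa using (h3 _ _).const_mul _

end Flat

/-! ### Pull-back of forms along smooth maps and the exterior derivative -/

section Naturality

variable {n m p : ℕ} {M : Type u} [TopologicalSpace M] [ChartedSpace (Euc n) M]
  {N : Type v} [TopologicalSpace N] [ChartedSpace (Euc m) N]

/-- The derivative of `f` at `y`, as a linear map between the model spaces (with which the tangent
spaces are identified by the preferred charts). -/
noncomputable def derivAt (n m : ℕ) {M : Type u} [TopologicalSpace M] [ChartedSpace (Euc n) M]
    {N : Type v} [TopologicalSpace N] [ChartedSpace (Euc m) N] (f : N → M) (y : N) :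
    Euc m →L[ℝ] Euc n :=
  mfderiv 𝓘(ℝ, Euc m) 𝓘(ℝ, Euc n) f y

theorem derivAt_comp {l : ℕ} {L : Type*} [TopologicalSpace L] [ChartedSpace (Euc l) L]
    {g : M → L} {f : N → M} {y : N}
    (hg : MDifferentiableAt 𝓘(ℝ, Euc n) 𝓘(ℝ, Euc l) g (f y))
    (hf : MDifferentiableAt 𝓘(ℝ, Euc m) 𝓘(ℝ, Euc n) f y) :
    derivAt l m (g ∘ f) y = (derivAt l n g (f y)).comp (derivAt n m f y) :=
  mfderiv_comp y hg hf

theorem derivAt_eq_fderiv (f : Euc m → Euc n) (a : Euc m) : derivAt n m f a = fderiv ℝ f a :=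
  mfderiv_eq_fderiv

/-- The value of a form at a point, as an alternating form on the model space. -/
noncomputable def Form.valueAt (θ : Form n M p) (y : M) : Euc n [⋀^Fin p]→L[ℝ] ℝ := θ y

/-- The pull-back of a form to `ℝᵐ`, as a function with values in a fixed space. -/
noncomputable def Form.onEuc (θ : Form n M p) (f : Euc m → M) : Euc m → Euc m [⋀^Fin p]→L[ℝ] ℝ :=
  fun a => (θ.valueAt (f a)).compContinuousLinearMap (derivAt n m f a)

theorem Form.inChart_eq_onEuc (θ : Form n M p) (y : M) :
    θ.inChart y = θ.onEuc (extChartAt 𝓘(ℝ, Euc n) y).symm := rfl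

theorem Form.valueAt_d (θ : Form n M p) (y : M) :
    θ.d.valueAt y = (extDeriv (θ.inChart y) (extChartAt 𝓘(ℝ, Euc n) y y)).compContinuousLinearMap
      (derivAt n n (extChartAt 𝓘(ℝ, Euc n) y) y) := rfl

/-- The form `θ` is smooth near `y`. -/
structure Form.SmoothAt (θ : Form n M p) (y : M) : Prop where
  contDiffAt_inChart_self : ContDiffAt ℝ ∞ (θ.inChart y) (extChartAt 𝓘(ℝ, Euc n) y y)

/-- The exterior derivative is a local operator. -/
theorem Form.d_congr {θ θ' : Form n M p} {y : M} (h : ∀ᶠ z in 𝓝 y, θ z = θ' z) :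
    θ.d y = θ'.d y := by
  have h1 : θ.inChart y =ᶠ[𝓝 (extChartAt 𝓘(ℝ, Euc n) y y)] θ'.inChart y := by
    have h2 := (continuousAt_extChartAt_symm (I := 𝓘(ℝ, Euc n)) y).eventually
      ((extChartAt_to_inv (I := 𝓘(ℝ, Euc n)) y).symm ▸ h)
    filter_upwards [h2] with a ha
    rw [Form.inChart, Form.inChart, ha]
  rw [Form.d, Form.d, h1.extDeriv_eq]

theorem extDeriv_zero_form : extDeriv (0 : Euc n → Euc n [⋀^Fin p]→L[ℝ] ℝ) = 0 := by
  ext a v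
  have hd : DifferentiableAt ℝ (0 : Euc n → Euc n [⋀^Fin p]→L[ℝ] ℝ) a := differentiableAt_const _
  simpa using extDeriv_apply hd v

theorem Form.d_eq_zero {θ : Form n M p} {y : M} (h : ∀ᶠ z in 𝓝 y, θ z = 0) : θ.d y = 0 := by
  have h1 : (0 : Form n M p).inChart y = 0 := by
    ext a v; rfl
  rw [Form.d_congr (θ' := 0) h, Form.d, h1, extDeriv_zero_form]
  ext v; rfl

theorem Form.inChart_eq_zero {θ : Form n M p} {y : M} {a : Euc n}
    (h : θ ((extChartAt 𝓘(ℝ, Euc n) y).symm a) = 0) : θ.inChart y a = 0 := by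
  rw [Form.inChart, h]
  ext v; rfl

theorem contMDiffAt_extChartAt_symm [IsManifold 𝓘(ℝ, Euc n) ∞ M] {y : M} {a : Euc n}
    (ha : a ∈ (extChartAt 𝓘(ℝ, Euc n) y).target) :
    ContMDiffAt 𝓘(ℝ, Euc n) 𝓘(ℝ, Euc n) ∞ (extChartAt 𝓘(ℝ, Euc n) y).symm a :=
  (contMDiffOn_extChartAt_symm y a ha).contMDiffAt ((isOpen_extChartAt_target y).mem_nhds ha)

theorem contMDiffAt_comp_extChartAt_symm [IsManifold 𝓘(ℝ, Euc m) ∞ N] {f : N → M}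
    (hf : ContMDiff 𝓘(ℝ, Euc m) 𝓘(ℝ, Euc n) ∞ f) (x : N) :
    ContMDiffAt 𝓘(ℝ, Euc m) 𝓘(ℝ, Euc n) ∞ (f ∘ (extChartAt 𝓘(ℝ, Euc m) x).symm)
      (extChartAt 𝓘(ℝ, Euc m) x x) :=
  (hf _).comp _ (contMDiffAt_extChartAt_symm (mem_extChartAt_target x))

theorem Form.inChart_pullback [IsManifold 𝓘(ℝ, Euc m) ∞ N] (θ : Form n M p) {f : N → M} {x : N}
    {a : Euc m} (ha : a ∈ (extChartAt 𝓘(ℝ, Euc m) x).target)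
    (hf : MDifferentiableAt 𝓘(ℝ, Euc m) 𝓘(ℝ, Euc n) f ((extChartAt 𝓘(ℝ, Euc m) x).symm a)) :
    (θ.pullback f).inChart x a = θ.onEuc (f ∘ (extChartAt 𝓘(ℝ, Euc m) x).symm) a := by
  rw [Form.onEuc, derivAt_comp hf ((contMDiffAt_extChartAt_symm ha).mdifferentiableAt (by simp))]
  rfl

theorem Form.inChart_pullback_eventuallyEq [IsManifold 𝓘(ℝ, Euc m) ∞ N] (θ : Form n M p)
    {f : N → M} (hf : ContMDiff 𝓘(ℝ, Euc m) 𝓘(ℝ, Euc n) ∞ f) (x : N) :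
    (θ.pullback f).inChart x =ᶠ[𝓝 (extChartAt 𝓘(ℝ, Euc m) x x)]
      θ.onEuc (f ∘ (extChartAt 𝓘(ℝ, Euc m) x).symm) := by
  filter_upwards [extChartAt_target_mem_nhds (I := 𝓘(ℝ, Euc m)) x] with a ha
  exact θ.inChart_pullback ha (hf.mdifferentiable (by simp) _)

variable [IsManifold 𝓘(ℝ, Euc n) ∞ M]

theorem derivAt_extChartAt_symm_comp {y z : M} (hz : z ∈ (chartAt (Euc n) y).source) :
    (derivAt n n (extChartAt 𝓘(ℝ, Euc n) y).symm (extChartAt 𝓘(ℝ, Euc n) y z)).comp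
      (derivAt n n (extChartAt 𝓘(ℝ, Euc n) y) z) = ContinuousLinearMap.id ℝ (Euc n) := by
  have : IsManifold 𝓘(ℝ, Euc n) 1 M := IsManifold.of_le (n := ∞) (by simp)
  have := mfderivWithin_extChartAt_symm_comp_mfderiv_extChartAt' (I := 𝓘(ℝ, Euc n)) (x := y)
    (y := z) (by simpa using hz)
  rw [derivAt, ← mfderivWithin_univ]
  rwa [ModelWithCorners.range_eq_univ] at this

theorem fderiv_extChartAt_comp {f : Euc m → M} {a : Euc m} {y : M}
    (hf : MDifferentiableAt 𝓘(ℝ, Euc m) 𝓘(ℝ, Euc n) f a)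
    (hy : f a ∈ (chartAt (Euc n) y).source) :
    fderiv ℝ (extChartAt 𝓘(ℝ, Euc n) y ∘ f) a =
      (derivAt n n (extChartAt 𝓘(ℝ, Euc n) y) (f a)).comp (derivAt n m f a) := by
  have : IsManifold 𝓘(ℝ, Euc n) 1 M := IsManifold.of_le (n := ∞) (by simp)
  rw [← derivAt_eq_fderiv]
  exact derivAt_comp (mdifferentiableAt_extChartAt hy) hf

theorem contDiffAt_extChartAt_comp {f : Euc m → M} {a : Euc m} {y : M}
    (hf : ContMDiffAt 𝓘(ℝ, Euc m) 𝓘(ℝ, Euc n) ∞ f a) (hy : f a ∈ (chartAt (Euc n) y).source) :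
    ContDiffAt ℝ ∞ (extChartAt 𝓘(ℝ, Euc n) y ∘ f) a :=
  ((contMDiffAt_extChartAt' hy).comp a hf).contDiffAt

theorem Form.onEuc_apply (θ : Form n M p) {f : Euc m → M} {a : Euc m} {y : M}
    (hf : MDifferentiableAt 𝓘(ℝ, Euc m) 𝓘(ℝ, Euc n) f a)
    (hy : f a ∈ (chartAt (Euc n) y).source) :
    θ.onEuc f a = (θ.inChart y (extChartAt 𝓘(ℝ, Euc n) y (f a))).compContinuousLinearMap
        (fderiv ℝ (extChartAt 𝓘(ℝ, Euc n) y ∘ f) a) := by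
  have h6 : derivAt n m f a =
      (derivAt n n (extChartAt 𝓘(ℝ, Euc n) y).symm (extChartAt 𝓘(ℝ, Euc n) y (f a))).comp
        (fderiv ℝ (extChartAt 𝓘(ℝ, Euc n) y ∘ f) a) := by
    rw [fderiv_extChartAt_comp hf hy, ← ContinuousLinearMap.comp_assoc,
      derivAt_extChartAt_symm_comp hy, ContinuousLinearMap.id_comp]
  rw [Form.onEuc, h6, Form.inChart_eq_onEuc, Form.onEuc,
    (extChartAt 𝓘(ℝ, Euc n) y).left_inv (by simpa using hy)]
  rfl

/-- Near a point of `ℝᵐ`, the pull-back of a form along a map into `M` is the pull-back of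
its expression in a chart. -/
theorem Form.onEuc_eventuallyEq (θ : Form n M p) {f : Euc m → M} {a : Euc m} {y : M}
    (hf : ContMDiffAt 𝓘(ℝ, Euc m) 𝓘(ℝ, Euc n) ∞ f a) (hy : f a ∈ (chartAt (Euc n) y).source) :
    θ.onEuc f =ᶠ[𝓝 a] fun b =>
      (θ.inChart y ((extChartAt 𝓘(ℝ, Euc n) y ∘ f) b)).compContinuousLinearMap
        (fderiv ℝ (extChartAt 𝓘(ℝ, Euc n) y ∘ f) b) := by
  have : IsManifold 𝓘(ℝ, Euc n) 1 M := IsManifold.of_le (n := ∞) (by simp)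
  have h1 : ∀ᶠ b in 𝓝 a, f b ∈ (chartAt (Euc n) y).source :=
    hf.continuousAt.eventually_mem ((chartAt (Euc n) y).open_source.mem_nhds hy)
  have h2 : ∀ᶠ b in 𝓝 a, ContMDiffAt 𝓘(ℝ, Euc m) 𝓘(ℝ, Euc n) 1 f b :=
    (contMDiffAt_iff_contMDiffAt_nhds (by simp)).1 (hf.of_le (by simp))
  filter_upwards [h1, h2] with b hb hfb
  exact θ.onEuc_apply (hfb.mdifferentiableAt one_ne_zero) hb

theorem Form.SmoothAt.contDiffAt_onEuc {θ : Form n M p} {f : Euc m → M} {a : Euc m}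
    (hθ : θ.SmoothAt (f a)) (hf : ContMDiffAt 𝓘(ℝ, Euc m) 𝓘(ℝ, Euc n) ∞ f a) :
    ContDiffAt ℝ ∞ (θ.onEuc f) a := by
  have h1 := contDiffAt_extChartAt_comp hf (mem_chart_source (Euc n) (f a))
  refine ContDiffAt.congr_of_eventuallyEq ?_
    (θ.onEuc_eventuallyEq hf (mem_chart_source (Euc n) (f a)))
  exact contDiffAt_compContinuousLinearMap (ContDiffAt.comp (g := θ.inChart (f a)) a hθ.1 h1)
    (h1.fderiv_right (m := ∞) (by simp))

/-- The exterior derivative commutes with pull-back along maps from `ℝᵐ`. -/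
theorem Form.SmoothAt.extDeriv_onEuc {θ : Form n M p} {f : Euc m → M} {a : Euc m}
    (hθ : θ.SmoothAt (f a)) (hf : ContMDiffAt 𝓘(ℝ, Euc m) 𝓘(ℝ, Euc n) ∞ f a) :
    extDeriv (θ.onEuc f) a = θ.d.onEuc f a := by
  have hy := mem_chart_source (Euc n) (f a)
  have h1 := contDiffAt_extChartAt_comp hf hy
  have h2 : DifferentiableAt ℝ (θ.inChart (f a)) ((extChartAt 𝓘(ℝ, Euc n) (f a) ∘ f) a) :=
    ContDiffAt.differentiableAt hθ.1 (by simp)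
  rw [(θ.onEuc_eventuallyEq hf hy).extDeriv_eq,
    extDeriv_pullback h2 (h1.of_le (m := 2) (by norm_cast)) (by simp),
    fderiv_extChartAt_comp (hf.mdifferentiableAt (by simp)) hy]
  rfl

theorem Form.SmoothAt.contDiffAt_inChart {θ : Form n M p} {y : M} {a : Euc n}
    (ha : a ∈ (extChartAt 𝓘(ℝ, Euc n) y).target)
    (hθ : θ.SmoothAt ((extChartAt 𝓘(ℝ, Euc n) y).symm a)) :
    ContDiffAt ℝ ∞ (θ.inChart y) a :=
  hθ.contDiffAt_onEuc (contMDiffAt_extChartAt_symm ha)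

theorem Form.SmoothAt.extDeriv_inChart {θ : Form n M p} {y : M} {a : Euc n}
    (ha : a ∈ (extChartAt 𝓘(ℝ, Euc n) y).target)
    (hθ : θ.SmoothAt ((extChartAt 𝓘(ℝ, Euc n) y).symm a)) :
    extDeriv (θ.inChart y) a = θ.d.inChart y a :=
  hθ.extDeriv_onEuc (contMDiffAt_extChartAt_symm ha)

variable [IsManifold 𝓘(ℝ, Euc m) ∞ N]

theorem Form.SmoothAt.pullback {θ : Form n M p} {f : N → M} {x : N} (hθ : θ.SmoothAt (f x))
    (hf : ContMDiff 𝓘(ℝ, Euc m) 𝓘(ℝ, Euc n) ∞ f) : (θ.pullback f : Form m N p).SmoothAt x := by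
  refine ⟨ContDiffAt.congr_of_eventuallyEq ?_ (θ.inChart_pullback_eventuallyEq hf x)⟩
  exact Form.SmoothAt.contDiffAt_onEuc (by simpa using hθ) (contMDiffAt_comp_extChartAt_symm hf x)

/-- The exterior derivative commutes with pull-back along smooth maps. -/
theorem Form.SmoothAt.d_pullback {θ : Form n M p} {f : N → M} {x : N} (hθ : θ.SmoothAt (f x))
    (hf : ContMDiff 𝓘(ℝ, Euc m) 𝓘(ℝ, Euc n) ∞ f) :
    (θ.pullback f : Form m N p).d x = (θ.d.pullback f : Form m N (p + 1)) x := by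
  have h1 : extDeriv ((θ.pullback f : Form m N p).inChart x) (extChartAt 𝓘(ℝ, Euc m) x x) =
      (θ.d.pullback f : Form m N (p + 1)).inChart x (extChartAt 𝓘(ℝ, Euc m) x x) := by
    rw [(θ.inChart_pullback_eventuallyEq hf x).extDeriv_eq,
      Form.SmoothAt.extDeriv_onEuc (by simpa using hθ) (contMDiffAt_comp_extChartAt_symm hf x),
      Form.inChart_pullback _ (mem_extChartAt_target x) (hf.mdifferentiable (by simp) _)]
  change (θ.pullback f : Form m N p).d.valueAt x = (θ.d.pullback f : Form m N (p + 1)).valueAt x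
  rw [Form.valueAt_d, h1, Form.inChart_eq_onEuc, Form.onEuc, extChartAt_to_inv]
  have h2 := derivAt_extChartAt_symm_comp (mem_chart_source (Euc m) x)
  ext v
  change (θ.d.pullback f : Form m N (p + 1)).valueAt x (fun i =>
    ((derivAt m m (extChartAt 𝓘(ℝ, Euc m) x).symm
    (extChartAt 𝓘(ℝ, Euc m) x x)).comp (derivAt m m (extChartAt 𝓘(ℝ, Euc m) x) x)) (v i)) = _
  rw [h2]
  rfl

end Naturality

end CohLFT

namespace CohLFT

/-! ### Change of charts in integrals of top degree forms -/

section Charts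

variable {n : ℕ} {M : Type u} [TopologicalSpace M] [ChartedSpace (Euc n) M]

/-- The sign of the orientation `o` at `w`, read in the preferred chart at `y`. -/
noncomputable def MfdOrientation.signInChart (o : MfdOrientation n M) (y w : M) : ℝ :=
  o.sign w * chartSign n y w

/-- The density on `ℝⁿ` that represents the top degree form `θ` in the preferred chart at `y`, with
the sign given by the orientation. -/
noncomputable def MfdOrientation.density (o : MfdOrientation n M) (θ : Form n M n) (y : M)
    (a : Euc n) : ℝ :=
  o.signInChart y ((extChartAt 𝓘(ℝ, Euc n) y).symm a) *
    θ.inChart y a (fun i => EuclideanSpace.basisFun (Fin n) ℝ i)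

theorem MfdOrientation.density_eq_zero (o : MfdOrientation n M) {θ : Form n M n} {y : M}
    {a : Euc n} (h : θ ((extChartAt 𝓘(ℝ, Euc n) y).symm a) = 0) : o.density θ y a = 0 := by
  rw [density, Form.inChart_eq_zero h]
  simp

theorem alternating_comp_basis (f : Euc n [⋀^Fin n]→L[ℝ] ℝ) (A : Euc n →L[ℝ] Euc n) :
    f (fun i => A (EuclideanSpace.basisFun (Fin n) ℝ i)) =
      A.det * f (fun i => EuclideanSpace.basisFun (Fin n) ℝ i) := by
  set e := (EuclideanSpace.basisFun (Fin n) ℝ).toBasis with he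
  have h1 := AlternatingMap.eq_smul_basis_det e f.toAlternatingMap
  have h2 : ∀ v : Fin n → Euc n, f v = f e * e.det v := fun v =>
    congrArg (fun B : Euc n [⋀^Fin n]→ₗ[ℝ] ℝ => B v) h1
  have h3 : (fun i => A (EuclideanSpace.basisFun (Fin n) ℝ i)) = (A : Euc n →ₗ[ℝ] Euc n) ∘ e := by
    ext i; simp [he]
  have h4 : (fun i => EuclideanSpace.basisFun (Fin n) ℝ i) = e := by
    ext i; simp [he]
  rw [h3, h2, Module.Basis.det_comp, h4, Module.Basis.det_self, mul_one, mul_comm]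

variable [IsManifold 𝓘(ℝ, Euc n) ∞ M]

theorem derivAt_extChartAt_transition {y z w : M} (hy : w ∈ (chartAt (Euc n) y).source)
    (hz : w ∈ (chartAt (Euc n) z).source) :
    derivAt n n (extChartAt 𝓘(ℝ, Euc n) z) w =
      (fderiv ℝ (extChartAt 𝓘(ℝ, Euc n) z ∘ (extChartAt 𝓘(ℝ, Euc n) y).symm)
        (extChartAt 𝓘(ℝ, Euc n) y w)).comp (derivAt n n (extChartAt 𝓘(ℝ, Euc n) y) w) := by
  have hw := (extChartAt 𝓘(ℝ, Euc n) y).left_inv (by simpa using hy : w ∈ _)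
  have ha : extChartAt 𝓘(ℝ, Euc n) y w ∈ (extChartAt 𝓘(ℝ, Euc n) y).target :=
    (extChartAt 𝓘(ℝ, Euc n) y).map_source (by simpa using hy)
  rw [fderiv_extChartAt_comp ((contMDiffAt_extChartAt_symm ha).mdifferentiableAt (by simp))
    (by rwa [hw]), hw, ContinuousLinearMap.comp_assoc, derivAt_extChartAt_symm_comp hy,
    ContinuousLinearMap.comp_id]

theorem det_derivAt_extChartAt_ne_zero {y w : M} (hy : w ∈ (chartAt (Euc n) y).source) :
    (derivAt n n (extChartAt 𝓘(ℝ, Euc n) y) w).det ≠ 0 := by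
  intro h
  have h1 := congrArg ContinuousLinearMap.det (derivAt_extChartAt_symm_comp hy)
  have h2 : ∀ A A' : Euc n →L[ℝ] Euc n, (A.comp A').det = A.det * A'.det := fun A A' =>
    LinearMap.det_comp (A : Euc n →ₗ[ℝ] Euc n) A'
  rw [h2, h, mul_zero] at h1
  simp [ContinuousLinearMap.det] at h1

theorem chartSign_transition {y z w : M} (hy : w ∈ (chartAt (Euc n) y).source)
    (hz : w ∈ (chartAt (Euc n) z).source) :
    chartSign n z w = SignType.sign (fderiv ℝ
      (extChartAt 𝓘(ℝ, Euc n) z ∘ (extChartAt 𝓘(ℝ, Euc n) y).symm)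
        (extChartAt 𝓘(ℝ, Euc n) y w)).det * chartSign n y w := by
  have h1 : ∀ z : M, chartSign n z w =
    SignType.sign (derivAt n n (extChartAt 𝓘(ℝ, Euc n) z) w).det := fun _ => rfl
  have h2 : ∀ A A' : Euc n →L[ℝ] Euc n, (A.comp A').det = A.det * A'.det := fun A A' =>
    LinearMap.det_comp (A : Euc n →ₗ[ℝ] Euc n) A'
  rw [h1, h1, derivAt_extChartAt_transition hy hz, h2, sign_mul]
  simp

theorem contDiffAt_transition {y z : M} {a : Euc n}
    (ha : a ∈ (extChartAt 𝓘(ℝ, Euc n) y).target)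
    (hz : (extChartAt 𝓘(ℝ, Euc n) y).symm a ∈ (chartAt (Euc n) z).source) :
    ContDiffAt ℝ ∞ (extChartAt 𝓘(ℝ, Euc n) z ∘ (extChartAt 𝓘(ℝ, Euc n) y).symm) a :=
  contDiffAt_extChartAt_comp (contMDiffAt_extChartAt_symm ha) hz

/-- The sign of an orientation is locally constant in every chart. -/
theorem MfdOrientation.signInChart_eventuallyEq (o : MfdOrientation n M) {y w : M}
    (hy : w ∈ (chartAt (Euc n) y).source) :
    ∀ᶠ w' in 𝓝 w, o.signInChart y w' = o.signInChart y w := by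
  let τ := extChartAt 𝓘(ℝ, Euc n) y ∘ (extChartAt 𝓘(ℝ, Euc n) w).symm
  let F : M → ℝ := fun w' => (fderiv ℝ τ (extChartAt 𝓘(ℝ, Euc n) w w')).det
  have hF0 : F w ≠ 0 := by
    intro h
    have h1 := det_derivAt_extChartAt_ne_zero hy
    rw [derivAt_extChartAt_transition (mem_chart_source (Euc n) w) hy] at h1
    refine h1 ((LinearMap.det_comp _ _).trans ?_)
    exact mul_eq_zero_of_left h _
  have hτ : ContDiffAt ℝ ∞ τ (extChartAt 𝓘(ℝ, Euc n) w w) :=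
    contDiffAt_transition (mem_extChartAt_target w) (by simpa using hy)
  have hF : ContinuousAt F w := by
    have h1 : ContinuousAt (fderiv ℝ τ) (extChartAt 𝓘(ℝ, Euc n) w w) :=
      (hτ.fderiv_right (m := 0) (by simp)).continuousAt
    exact ContinuousLinearMap.continuous_det.continuousAt.comp
      (ContinuousAt.comp (g := fderiv ℝ τ) h1 (continuousAt_extChartAt w))
  have h2 : ∀ᶠ w' in 𝓝 w, SignType.sign (F w') = SignType.sign (F w) := by
    rcases lt_or_gt_of_ne hF0 with h | h
    · filter_upwards [hF.eventually_lt_const h] with w' hw'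
      rw [sign_neg hw', sign_neg h]
    · filter_upwards [hF.eventually_const_lt h] with w' hw'
      rw [sign_pos hw', sign_pos h]
  -- The orientation is continuous in the chart at `w`; the transition to the chart at `y`
  -- multiplies the sign by that of the Jacobian determinant `F`.
  have h3 : ∀ᶠ w' in 𝓝 w, o.signInChart y w' = SignType.sign (F w) * o.sign w := by
    filter_upwards [h2, o.continuous w, chart_source_mem_nhds (Euc n) w,
      (chartAt (Euc n) y).open_source.mem_nhds hy] with w' h4 h5 h6 h7
    rw [signInChart, chartSign_transition h6 h7, ← h5, ← h4]
    ring
  filter_upwards [h3] with w' hw'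
  rw [hw', h3.self_of_nhds]

theorem MfdOrientation.density_transition (o : MfdOrientation n M) (θ : Form n M n) {y z : M}
    {a : Euc n} (ha : a ∈ (extChartAt 𝓘(ℝ, Euc n) y).target)
    (hz : (extChartAt 𝓘(ℝ, Euc n) y).symm a ∈ (chartAt (Euc n) z).source) :
    o.density θ y a =
      |(fderiv ℝ (extChartAt 𝓘(ℝ, Euc n) z ∘ (extChartAt 𝓘(ℝ, Euc n) y).symm) a).det| *
      o.density θ z ((extChartAt 𝓘(ℝ, Euc n) z ∘ (extChartAt 𝓘(ℝ, Euc n) y).symm) a) := by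
  set w := (extChartAt 𝓘(ℝ, Euc n) y).symm a with hw
  have hwy : w ∈ (chartAt (Euc n) y).source := by
    rw [← extChartAt_source 𝓘(ℝ, Euc n)]
    exact (extChartAt 𝓘(ℝ, Euc n) y).map_target ha
  have h1 : extChartAt 𝓘(ℝ, Euc n) y w = a := (extChartAt 𝓘(ℝ, Euc n) y).right_inv ha
  have h2 : (extChartAt 𝓘(ℝ, Euc n) z).symm (extChartAt 𝓘(ℝ, Euc n) z w) = w :=
    (extChartAt 𝓘(ℝ, Euc n) z).left_inv (by simpa using hz)
  have h3 := chartSign_transition hwy hz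
  have h4 : θ.inChart y a = _ := θ.onEuc_apply
    ((contMDiffAt_extChartAt_symm ha).mdifferentiableAt (by simp)) hz
  rw [density, density, Function.comp_apply, ← hw, h2, signInChart, signInChart, h3, h4, h1, ← hw]
  rw [ContinuousAlternatingMap.compContinuousLinearMap_apply]
  set D := fderiv ℝ (extChartAt 𝓘(ℝ, Euc n) z ∘ (extChartAt 𝓘(ℝ, Euc n) y).symm) a
  have h5 := alternating_comp_basis (θ.inChart z (extChartAt 𝓘(ℝ, Euc n) z w)) D
  have h6 : |D.det| * SignType.sign D.det = D.det := by rw [mul_comm, sign_mul_abs]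
  refine (congrArg (o.sign w * chartSign n y w * ·) h5).trans ?_
  linear_combination (- (o.sign w * chartSign n y w * (θ.inChart z (extChartAt 𝓘(ℝ, Euc n) z w))
    (fun i => EuclideanSpace.basisFun (Fin n) ℝ i))) * h6

/-- Change of variables: the integral of a density supported in the domains of two charts
can be computed in either of them. -/
theorem MfdOrientation.integral_density_eq (o : MfdOrientation n M) (θ : Form n M n) (h : M → ℝ)
    (y z : M) (h0 : ∀ w, ¬ (w ∈ (chartAt (Euc n) y).source ∧ w ∈ (chartAt (Euc n) z).source) →
      h w = 0 ∨ θ w = 0) :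
    ∫ a in (extChartAt 𝓘(ℝ, Euc n) y).target,
        h ((extChartAt 𝓘(ℝ, Euc n) y).symm a) * o.density θ y a =
      ∫ a in (extChartAt 𝓘(ℝ, Euc n) z).target,
        h ((extChartAt 𝓘(ℝ, Euc n) z).symm a) * o.density θ z a := by
  have key : ∀ y z : M, (∀ w, ¬ (w ∈ (chartAt (Euc n) y).source ∧
        w ∈ (chartAt (Euc n) z).source) → h w = 0 ∨ θ w = 0) →
      ∫ a in (extChartAt 𝓘(ℝ, Euc n) y).target,
        h ((extChartAt 𝓘(ℝ, Euc n) y).symm a) * o.density θ y a =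
      ∫ a in (extChartAt 𝓘(ℝ, Euc n) y).target ∩
        (extChartAt 𝓘(ℝ, Euc n) y).symm ⁻¹' (extChartAt 𝓘(ℝ, Euc n) z).source,
        h ((extChartAt 𝓘(ℝ, Euc n) y).symm a) * o.density θ y a := by
    intro y z h0
    refine setIntegral_eq_of_subset_of_forall_sdiff_eq_zero
      (isOpen_extChartAt_target y).measurableSet inter_subset_left ?_
    rintro a ⟨ha, hna⟩
    rcases h0 ((extChartAt 𝓘(ℝ, Euc n) y).symm a) (fun hw => hna ⟨ha, by simpa using hw.2⟩)
      with h1 | h1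
    · rw [h1, zero_mul]
    · rw [o.density_eq_zero h1, mul_zero]
  rw [key y z h0, key z y (fun w hw => h0 w (fun hw' => hw hw'.symm))]
  set e := (extChartAt 𝓘(ℝ, Euc n) y).symm.trans (extChartAt 𝓘(ℝ, Euc n) z) with he
  have h1 : (extChartAt 𝓘(ℝ, Euc n) z).target ∩
      (extChartAt 𝓘(ℝ, Euc n) z).symm ⁻¹' (extChartAt 𝓘(ℝ, Euc n) y).source =
      e '' e.source := e.image_source_eq_target.symm
  have hopen : IsOpen e.source :=
    (continuousOn_extChartAt_symm (I := 𝓘(ℝ, Euc n)) y).isOpen_inter_preimage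
      (isOpen_extChartAt_target y) (isOpen_extChartAt_source z)
  have hd : ∀ a ∈ e.source, HasFDerivWithinAt e (fderiv ℝ e a) e.source a := fun a ha => by
    have := contDiffAt_transition (y := y) (z := z) ha.1 (by simpa using ha.2)
    exact (this.differentiableAt (by simp)).hasFDerivAt.hasFDerivWithinAt
  rw [h1, integral_image_eq_integral_abs_det_fderiv_smul volume hopen.measurableSet hd e.injOn]
  refine setIntegral_congr_fun hopen.measurableSet fun a ha => ?_
  have hz : (extChartAt 𝓘(ℝ, Euc n) y).symm a ∈ (extChartAt 𝓘(ℝ, Euc n) z).source := ha.2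
  have h2 : (extChartAt 𝓘(ℝ, Euc n) z).symm (e a) = (extChartAt 𝓘(ℝ, Euc n) y).symm a :=
    (extChartAt 𝓘(ℝ, Euc n) z).left_inv hz
  have h3 := o.density_transition θ ha.1 (by simpa using hz)
  simp only [h2, smul_eq_mul]
  rw [h3]
  exact mul_left_comm _ _ _

theorem MfdOrientation.integrableOn_density (o : MfdOrientation n M) {θ : Form n M n} {h : M → ℝ}
    {y : M} {K : Set M} (hK : IsCompact K) (hKy : K ⊆ (chartAt (Euc n) y).source)
    (hh : Continuous h)
    (hθ : ContinuousOn (θ.inChart y) (extChartAt 𝓘(ℝ, Euc n) y).target)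
    (h0 : ∀ w ∉ K, h w = 0 ∨ θ w = 0) :
    IntegrableOn (fun a => h ((extChartAt 𝓘(ℝ, Euc n) y).symm a) * o.density θ y a)
      (extChartAt 𝓘(ℝ, Euc n) y).target := by
  have hKy' : K ⊆ (extChartAt 𝓘(ℝ, Euc n) y).source := by simpa using hKy
  have hK' : IsCompact (extChartAt 𝓘(ℝ, Euc n) y '' K) :=
    hK.image_of_continuousOn ((continuousOn_extChartAt y).mono hKy')
  have hsub : extChartAt 𝓘(ℝ, Euc n) y '' K ⊆ (extChartAt 𝓘(ℝ, Euc n) y).target := by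
    rintro _ ⟨w, hw, rfl⟩
    exact (extChartAt 𝓘(ℝ, Euc n) y).map_source (hKy' hw)
  have hsymm := continuousOn_extChartAt_symm (I := 𝓘(ℝ, Euc n)) y
  have hsign : ContinuousOn (fun a => o.signInChart y ((extChartAt 𝓘(ℝ, Euc n) y).symm a))
      (extChartAt 𝓘(ℝ, Euc n) y).target := by
    intro a ha
    have h1 := o.signInChart_eventuallyEq (y := y) (w := (extChartAt 𝓘(ℝ, Euc n) y).symm a)
      (by simpa using (extChartAt 𝓘(ℝ, Euc n) y).map_target ha)
    exact ContinuousWithinAt.congr_of_eventuallyEq continuousWithinAt_const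
      ((hsymm a ha).eventually h1) rfl
  have hcont : ContinuousOn
      (fun a => h ((extChartAt 𝓘(ℝ, Euc n) y).symm a) * o.density θ y a)
      (extChartAt 𝓘(ℝ, Euc n) y).target :=
    (hh.comp_continuousOn hsymm).mul (hsign.mul
      ((ContinuousAlternatingMap.apply ℝ (Euc n) ℝ _).continuous.comp_continuousOn hθ))
  refine ((hcont.mono hsub).integrableOn_compact hK').of_forall_sdiff_eq_zero
    (isOpen_extChartAt_target y).measurableSet ?_
  rintro a ⟨ha, hna⟩
  have h1 : (extChartAt 𝓘(ℝ, Euc n) y).symm a ∉ K := fun hw =>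
    hna ⟨_, hw, (extChartAt 𝓘(ℝ, Euc n) y).right_inv ha⟩
  rcases h0 _ h1 with h2 | h2
  · rw [h2, zero_mul]
  · rw [o.density_eq_zero h2, mul_zero]

end Charts

/-! ### Stokes' theorem on manifolds without boundary -/

section Stokes

variable {p : ℕ} {M : Type u} [TopologicalSpace M] [ChartedSpace (Euc (p + 1)) M]
  [IsManifold 𝓘(ℝ, Euc (p + 1)) ∞ M]

/-- Stokes' theorem for a form supported in the domain of a chart: in the chart, the form times the
locally constant orientation sign extends by zero to a form on `ℝᵖ⁺¹`. -/
theorem MfdOrientation.integral_density_d_eq_zero [T2Space M] (o : MfdOrientation (p + 1) M)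
    {θ : Form (p + 1) M p} (hθ : ∀ w, θ.SmoothAt w) {z : M} {K : Set M} (hK : IsCompact K)
    (hKz : K ⊆ (chartAt (Euc (p + 1)) z).source) (h0 : ∀ w ∉ K, θ w = 0) :
    ∫ a in (extChartAt 𝓘(ℝ, Euc (p + 1)) z).target, o.density θ.d z a = 0 := by
  classical
  set c := extChartAt 𝓘(ℝ, Euc (p + 1)) z with hc
  have hKz' : K ⊆ c.source := by simpa [hc] using hKz
  have hK' : IsCompact (c '' K) :=
    hK.image_of_continuousOn ((continuousOn_extChartAt z).mono hKz')
  have hT : IsOpen c.target := isOpen_extChartAt_target z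
  -- The sign is locally constant and `θ` vanishes near the boundary of the chart, so `η` is smooth.
  let η : Euc (p + 1) → Euc (p + 1) [⋀^Fin p]→L[ℝ] ℝ := fun a =>
    if a ∈ c.target then o.signInChart z (c.symm a) • θ.inChart z a else 0
  have hη0 : ∀ a ∉ c '' K, η a = 0 := fun a ha => by
    by_cases haT : a ∈ c.target
    · have h1 : c.symm a ∉ K := fun hw => ha ⟨_, hw, c.right_inv haT⟩
      simp only [η, if_pos haT, Form.inChart_eq_zero (h0 _ h1), smul_zero]
    · simp only [η, if_neg haT]
  have hηT : ∀ a ∈ c.target, η =ᶠ[𝓝 a] o.signInChart z (c.symm a) • θ.inChart z := by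
    intro a ha
    have h1 := (contMDiffAt_extChartAt_symm ha).continuousAt.eventually
      (o.signInChart_eventuallyEq (y := z) (w := c.symm a) (by simpa [hc] using c.map_target ha))
    filter_upwards [h1, hT.mem_nhds ha] with b hb hbT
    simp only [η, if_pos hbT, Pi.smul_apply]
    rw [hb]
  have hηn : ∀ a ∉ c.target, η =ᶠ[𝓝 a] 0 := by
    intro a ha
    have h1 : a ∉ c '' K := by
      rintro ⟨w, hw, rfl⟩
      exact ha (c.map_source (hKz' hw))
    filter_upwards [hK'.isClosed.isOpen_compl.mem_nhds h1] with b hb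
    exact hη0 b hb
  have hsm : ContDiff ℝ ∞ η := contDiff_iff_contDiffAt.2 fun a => by
    by_cases ha : a ∈ c.target
    · exact (contDiffAt_const.smul ((hθ _).contDiffAt_inChart ha)).congr_of_eventuallyEq (hηT a ha)
    · exact contDiffAt_const.congr_of_eventuallyEq (hηn a ha)
  have hcs : HasCompactSupport η := HasCompactSupport.intro hK' hη0
  have h1 := integral_extDeriv_eq_zero hsm hcs
    (fun i => EuclideanSpace.basisFun (Fin (p + 1)) ℝ i)
  rw [← setIntegral_eq_integral_of_forall_compl_eq_zero (s := c.target)] at h1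
  · rw [← h1]
    refine setIntegral_congr_fun hT.measurableSet fun a ha => ?_
    have h2 : extDeriv η a = o.signInChart z (c.symm a) • θ.d.inChart z a := by
      rw [(hηT a ha).extDeriv_eq, extDeriv_smul, (hθ _).extDeriv_inChart ha]
    change _ = extDeriv η a _
    rw [h2]
    rfl
  · intro a ha
    rw [(hηn a ha).extDeriv_eq, extDeriv_zero_form]
    rfl

theorem contDiffAt_extDeriv {E : Type*} [NormedAddCommGroup E] [NormedSpace ℝ E] {q : ℕ}
    {η : E → E [⋀^Fin q]→L[ℝ] ℝ} {a : E} (h : ContDiffAt ℝ ∞ η a) :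
    ContDiffAt ℝ ∞ (extDeriv η) a :=
  ContDiffAt.comp (g := ContinuousAlternatingMap.alternatizeUncurryFinCLM ℝ E ℝ) a
    (ContinuousLinearMap.contDiff _).contDiffAt
    (h.fderiv_right (m := ∞) (by simp))

theorem extDeriv_sum {E ι : Type*} [NormedAddCommGroup E] [NormedSpace ℝ E] {q : ℕ}
    {η : ι → E → E [⋀^Fin q]→L[ℝ] ℝ} {a : E} {S : Finset ι}
    (h : ∀ i ∈ S, DifferentiableAt ℝ (η i) a) :
    extDeriv (fun b => ∑ i ∈ S, η i b) a = ∑ i ∈ S, extDeriv (η i) a := by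
  rw [extDeriv, fderiv_fun_sum h]
  exact map_sum (ContinuousAlternatingMap.alternatizeUncurryFinCLM ℝ E ℝ) _ _

theorem Form.SmoothAt.smul {n q : ℕ} {N : Type*} [TopologicalSpace N] [ChartedSpace (Euc n) N]
    [IsManifold 𝓘(ℝ, Euc n) ∞ N] {θ : Form n N q} {f : N → ℝ} {w : N} (hθ : θ.SmoothAt w)
    (hf : ContMDiff 𝓘(ℝ, Euc n) 𝓘(ℝ, ℝ) ∞ f) : Form.SmoothAt (fun w => f w • θ w) w :=
  ⟨((hf _).comp _ (contMDiffAt_extChartAt_symm (mem_extChartAt_target w))).contDiffAt.smul hθ.1⟩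

variable [T2Space M] [SigmaCompactSpace M]

theorem tsupport_chartPartition_subset {n : ℕ} {N : Type*} [TopologicalSpace N]
    [ChartedSpace (Euc n) N] [IsManifold 𝓘(ℝ, Euc n) ∞ N] [T2Space N] [SigmaCompactSpace N]
    (y : N) : tsupport (chartPartition n N y) ⊆ (chartAt (Euc n) y).source :=
  (SmoothPartitionOfUnity.exists_isSubordinate_chartAt_source 𝓘(ℝ, Euc n) N).choose_spec y

theorem integral_eq_finsum_density {n : ℕ} {N : Type*} [TopologicalSpace N]
    [ChartedSpace (Euc n) N] [IsManifold 𝓘(ℝ, Euc n) ∞ N] [T2Space N] [SigmaCompactSpace N]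
    (o : MfdOrientation n N) (θ : Form n N n) :
    integral o θ = ∑ᶠ y : N, ∫ a in (extChartAt 𝓘(ℝ, Euc n) y).target,
      chartPartition n N y ((extChartAt 𝓘(ℝ, Euc n) y).symm a) * o.density θ y a := by
  simp only [integral, MfdOrientation.density, MfdOrientation.signInChart, mul_assoc]

/-- Stokes' theorem: the exterior derivative of a compactly supported form of codimension one on an
oriented manifold without boundary has integral zero. -/
theorem integral_d_eq_zero (o : MfdOrientation (p + 1) M) {θ : Form (p + 1) M p}
    (hθ : ∀ w, θ.SmoothAt w) {K : Set M} (hK : IsCompact K) (h0 : ∀ w ∉ K, θ w = 0) :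
    integral o θ.d = 0 := by
  classical
  -- Only the finitely many members `ρ y`, `y ∈ S`, of the partition of unity matter on `K`.
  set ρ := chartPartition (p + 1) M with hρ
  have hfin : {y | (Function.support (ρ y) ∩ K).Nonempty}.Finite :=
    ρ.locallyFinite.finite_nonempty_inter_compact hK
  set S := hfin.toFinset with hS
  have hSK : ∀ y ∉ S, ∀ w ∈ K, ρ y w = 0 := fun y hy w hw => by
    by_contra hne
    exact hy (hfin.mem_toFinset.2 ⟨w, hne, hw⟩)
  have hsum : ∀ w ∈ K, ∑ y ∈ S, ρ y w = 1 := fun w hw => by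
    rw [← ρ.sum_eq_one (mem_univ w)]
    refine (finsum_eq_sum_of_support_subset _ fun y hy => ?_).symm
    by_contra hne
    exact hy (hSK y hne w hw)
  have hd0 : ∀ (θ : Form (p + 1) M p) (K : Set M), IsClosed K → (∀ w ∉ K, θ w = 0) →
      ∀ w ∉ K, θ.d w = 0 := fun θ K hK h0 w hw =>
    Form.d_eq_zero (by filter_upwards [hK.isOpen_compl.mem_nhds hw] with w' hw' using h0 w' hw')
  let θ' : M → Form (p + 1) M p := fun z w => ρ z w • θ w
  have hθ' : ∀ z w, (θ' z).SmoothAt w := fun z w => (hθ w).smul (ρ z).contMDiff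
  have hθ'0 : ∀ z, ∀ w ∉ tsupport (ρ z) ∩ K, θ' z w = 0 := fun z w hw => by
    by_cases h1 : w ∈ K
    · have h2 : ρ z w = 0 := image_eq_zero_of_notMem_tsupport fun h => hw ⟨h, h1⟩
      simp only [θ', h2, zero_smul]
    · simp only [θ', h0 w h1, smul_zero]
  have hcpt : ∀ z, IsCompact (tsupport (ρ z) ∩ K) := fun z =>
    hK.inter_left (isClosed_tsupport _)
  have hθ'd : ∀ z, ∀ w ∉ tsupport (ρ z) ∩ K, (θ' z).d w = 0 := fun z =>
    hd0 _ _ (hcpt z).isClosed (hθ'0 z)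
  have hsub : ∀ z, tsupport (ρ z) ⊆ (chartAt (Euc (p + 1)) z).source :=
    tsupport_chartPartition_subset
  have hcont : ∀ z y, ContinuousOn ((θ' z).d.inChart y)
      (extChartAt 𝓘(ℝ, Euc (p + 1)) y).target := fun z y a ha => by
    refine ContinuousWithinAt.congr (f := extDeriv ((θ' z).inChart y)) ?_
      (fun b hb => ((hθ' z _).extDeriv_inChart hb).symm) ((hθ' z _).extDeriv_inChart ha).symm
    exact (contDiffAt_extDeriv ((hθ' z _).contDiffAt_inChart ha)).continuousAt.continuousWithinAt
  have hdecomp : ∀ y, ∀ a ∈ (extChartAt 𝓘(ℝ, Euc (p + 1)) y).target,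
      o.density θ.d y a = ∑ z ∈ S, o.density (θ' z).d y a := by
    intro y a ha
    have h1 : θ.inChart y = fun b => ∑ z ∈ S, (θ' z).inChart y b := by
      ext b v
      rw [ContinuousAlternatingMap.sum_apply]
      set w := (extChartAt 𝓘(ℝ, Euc (p + 1)) y).symm b
      change θ.inChart y b v = ∑ z ∈ S, ρ z w * θ.inChart y b v
      by_cases hw : w ∈ K
      · rw [← Finset.sum_mul, hsum w hw, one_mul]
      · rw [Form.inChart_eq_zero (h0 w hw)]
        simp
    have h2 : θ.d.inChart y a = ∑ z ∈ S, (θ' z).d.inChart y a := by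
      rw [← (hθ _).extDeriv_inChart ha, h1, extDeriv_sum fun z _ =>
        ((hθ' z _).contDiffAt_inChart ha).differentiableAt (by simp)]
      exact Finset.sum_congr rfl fun z _ => (hθ' z _).extDeriv_inChart ha
    simp only [MfdOrientation.density]
    rw [h2, ContinuousAlternatingMap.sum_apply, Finset.mul_sum]
  have hint : ∀ y z z', (z' = y ∨ z' = z) → IntegrableOn
      (fun a => ρ y ((extChartAt 𝓘(ℝ, Euc (p + 1)) z').symm a) * o.density (θ' z).d z' a)
      (extChartAt 𝓘(ℝ, Euc (p + 1)) z').target := by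
    rintro y z z' (rfl | rfl)
    · refine o.integrableOn_density (hcpt z') (inter_subset_left.trans (hsub z'))
        (ρ z').contMDiff.continuous (hcont _ _) fun w hw => ?_
      by_cases h1 : w ∈ K
      · exact Or.inl (image_eq_zero_of_notMem_tsupport fun h => hw ⟨h, h1⟩)
      · exact Or.inr (hθ'd z w fun h => h1 h.2)
    · exact o.integrableOn_density (hcpt z') (inter_subset_left.trans (hsub z'))
        (ρ y).contMDiff.continuous (hcont _ _) fun w hw => Or.inr (hθ'd z' w hw)
  -- Split `θ = ∑ θ' z` in each chart, move the integral of `d (θ' z)` to the chart at `z`, and sum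
  -- the partition of unity over `y`.
  rw [integral_eq_finsum_density, finsum_eq_sum_of_support_subset (s := S)]
  · calc _ = ∑ y ∈ S, ∑ z ∈ S, ∫ a in (extChartAt 𝓘(ℝ, Euc (p + 1)) y).target,
          ρ y ((extChartAt 𝓘(ℝ, Euc (p + 1)) y).symm a) * o.density (θ' z).d y a := by
          refine Finset.sum_congr rfl fun y _ => ?_
          rw [← integral_finsetSum _ fun z _ => hint y z y (Or.inl rfl)]
          refine setIntegral_congr_fun (isOpen_extChartAt_target y).measurableSet fun a ha => ?_
          simp only [hdecomp y a ha, Finset.mul_sum]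
          rfl
      _ = ∑ y ∈ S, ∑ z ∈ S, ∫ a in (extChartAt 𝓘(ℝ, Euc (p + 1)) z).target,
          ρ y ((extChartAt 𝓘(ℝ, Euc (p + 1)) z).symm a) * o.density (θ' z).d z a := by
          refine Finset.sum_congr rfl fun y _ => Finset.sum_congr rfl fun z _ => ?_
          refine o.integral_density_eq _ (ρ y) y z fun w hw => ?_
          by_cases h1 : w ∈ tsupport (ρ y)
          · exact Or.inr (hθ'd z w fun h => hw ⟨hsub y h1, hsub z h.1⟩)
          · exact Or.inl (image_eq_zero_of_notMem_tsupport h1)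
      _ = ∑ z ∈ S, ∫ a in (extChartAt 𝓘(ℝ, Euc (p + 1)) z).target, o.density (θ' z).d z a := by
          rw [Finset.sum_comm]
          refine Finset.sum_congr rfl fun z _ => ?_
          rw [← integral_finsetSum _ fun y _ => hint y z z (Or.inr rfl)]
          refine setIntegral_congr_fun (isOpen_extChartAt_target z).measurableSet fun a _ => ?_
          simp only [← Finset.sum_mul]
          by_cases h1 : (extChartAt 𝓘(ℝ, Euc (p + 1)) z).symm a ∈ K
          · rw [hsum _ h1, one_mul]
          · rw [o.density_eq_zero (hθ'd z _ fun h => h1 h.2), mul_zero]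
      _ = 0 := Finset.sum_eq_zero fun z _ =>
          o.integral_density_d_eq_zero (hθ' z) (hcpt z) (inter_subset_left.trans (hsub z)) (hθ'0 z)
  · intro y hy
    by_contra hne
    refine hy ?_
    refine (setIntegral_congr_fun (g := fun _ => (0 : ℝ))
      (isOpen_extChartAt_target y).measurableSet fun a _ => ?_).trans (by simp)
    by_cases h1 : (extChartAt 𝓘(ℝ, Euc (p + 1)) y).symm a ∈ K
    · exact mul_eq_zero_of_left (hSK y hne _ h1) _
    · exact mul_eq_zero_of_right _ (o.density_eq_zero (hd0 θ K hK.isClosed h0 _ h1))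

end Stokes

end CohLFT

namespace CohLFT

/-! ### Frames through a given point -/

section Frames

variable {n : ℕ} {M : Type u} [TopologicalSpace M] [ChartedSpace (Euc n) M]
  {EG : Type v₁} [NormedAddCommGroup EG] [NormedSpace ℝ EG]
  {G : Type v} [TopologicalSpace G] [ChartedSpace EG G] [Group G]
  {EP : Type w₁} [NormedAddCommGroup EP] [NormedSpace ℝ EP]
  {P : Type w} [TopologicalSpace P] [ChartedSpace EP P]
  {B : PrincipalBundle n M EG G EP P}

theorem Frame.translate_zero (e : Frame B) : e.translate 0 = e :=
  Subtype.ext (funext fun b => congrArg e.1 (zero_add b))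

theorem Frame.base_translate_zero (e : Frame B) (a : Euc n) : (e.translate a).base 0 = e.base a :=
  congrArg e.base (add_zero a)

theorem Frame.contMDiff_base (e : Frame B) : ContMDiff 𝓘(ℝ, Euc n) 𝓘(ℝ, Euc n) ∞ e.base :=
  B.contMDiff_proj.comp e.2.1

/-- A frame at `y`: compose a local section of `P` with the inverse of a chart, restricted to a
ball that is identified with `ℝⁿ`. In the chart, the base map has the smooth inverse `g`. -/
theorem exists_frame [IsManifold 𝓘(ℝ, Euc n) ∞ M] (B : PrincipalBundle n M EG G EP P) (y : M) :
    ∃ (e : Frame B) (g : Euc n → Euc n), e.base 0 = y ∧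
      g (extChartAt 𝓘(ℝ, Euc n) y y) = 0 ∧ ContDiffAt ℝ ∞ g (extChartAt 𝓘(ℝ, Euc n) y y) ∧
      ∀ᶠ a in 𝓝 (extChartAt 𝓘(ℝ, Euc n) y y),
        e.base (g a) = (extChartAt 𝓘(ℝ, Euc n) y).symm a := by
  obtain ⟨U, hU, hyU, σ, τ, hσ, -, hproj, -⟩ := B.locally_trivial y
  set c := extChartAt 𝓘(ℝ, Euc n) y with hc
  have hV : IsOpen (c.target ∩ c.symm ⁻¹' U) :=
    (continuousOn_extChartAt_symm (I := 𝓘(ℝ, Euc n)) y).isOpen_inter_preimage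
      (isOpen_extChartAt_target y) hU
  have hyV : c y ∈ c.target ∩ c.symm ⁻¹' U :=
    ⟨mem_extChartAt_target y, by simpa [hc] using hyU⟩
  obtain ⟨r, hr, hball⟩ := Metric.isOpen_iff.1 hV _ hyV
  set β := OpenPartialHomeomorph.univBall (c y) r with hβ
  have hβt : β.target = Metric.ball (c y) r := OpenPartialHomeomorph.univBall_target _ hr
  have hβs : β.source = univ := OpenPartialHomeomorph.univBall_source _ _
  have hβV : ∀ b, β b ∈ c.target ∩ c.symm ⁻¹' U := fun b =>
    hball (hβt ▸ β.map_source (by rw [hβs]; trivial))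
  have hβd : ContDiff ℝ ∞ β := OpenPartialHomeomorph.contDiff_univBall
  have hβd' : ContDiffOn ℝ ∞ β.symm (Metric.ball (c y) r) :=
    OpenPartialHomeomorph.contDiffOn_univBall_symm
  have hε : ContMDiff 𝓘(ℝ, Euc n) 𝓘(ℝ, Euc n) ∞ (c.symm ∘ β) := fun b =>
    (contMDiffAt_extChartAt_symm (hβV b).1).comp b hβd.contMDiff.contMDiffAt
  have hpe : (fun b => B.proj (σ (c.symm (β b)))) = c.symm ∘ β :=
    funext fun b => hproj _ (hβV b).2
  refine ⟨⟨fun b => σ (c.symm (β b)), fun b => ?_, fun b => ?_⟩, β.symm, ?_, ?_, ?_, ?_⟩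
  · exact ((hσ _ (hβV b).2).contMDiffAt (hU.mem_nhds (hβV b).2)).comp b (hε b)
  · rw [hpe]
    change Function.Bijective (derivAt n n (c.symm ∘ β) b)
    have h1 : ContDiffAt ℝ ∞ β.symm (β b) :=
      hβd'.contDiffAt (Metric.isOpen_ball.mem_nhds (hβt ▸ β.map_source (by rw [hβs]; trivial)))
    have h2 : ContMDiffAt 𝓘(ℝ, Euc n) 𝓘(ℝ, Euc n) ∞ c (c.symm (β b)) :=
      contMDiffAt_extChartAt' (by simpa [hc] using c.map_target (hβV b).1)
    have h3 : ContMDiffAt 𝓘(ℝ, Euc n) 𝓘(ℝ, Euc n) ∞ (β.symm ∘ c) (c.symm (β b)) :=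
      ContMDiffAt.comp _ (by rw [c.right_inv (hβV b).1]; exact h1.contMDiffAt) h2
    have h4 : (β.symm ∘ c) ∘ (c.symm ∘ β) = id := funext fun b => by
      simp only [Function.comp_apply, id_eq]
      rw [c.right_inv (hβV b).1, β.left_inv (by rw [hβs]; trivial)]
    have h5 := derivAt_comp (l := n) (n := n) (m := n) (y := b) (g := β.symm ∘ c)
      (f := c.symm ∘ β) (h3.mdifferentiableAt (by simp)) ((hε b).mdifferentiableAt (by simp))
    rw [h4, derivAt_eq_fderiv, fderiv_id] at h5
    -- The base map has a differentiable left inverse, so its derivative is injective.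
    have h6 : Function.Injective (derivAt n n (c.symm ∘ β) b) := fun v v' hv => by
      have h7 := congrArg (derivAt n n (β.symm ∘ c) (c.symm (β b))) hv
      have h8 : ∀ v, derivAt n n (β.symm ∘ c) (c.symm (β b)) (derivAt n n (c.symm ∘ β) b v) = v :=
        fun v => (congrArg (fun A : Euc n →L[ℝ] Euc n => A v) h5).symm
      rwa [h8, h8] at h7
    exact ⟨h6, (LinearMap.injective_iff_surjective
      (f := (derivAt n n (c.symm ∘ β) b : Euc n →ₗ[ℝ] Euc n))).1 h6⟩
  · refine (congrFun hpe 0).trans ?_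
    rw [Function.comp_apply, hβ, OpenPartialHomeomorph.univBall_apply_zero]
    exact extChartAt_to_inv y
  · exact OpenPartialHomeomorph.univBall_symm_apply_center _ _
  · exact hβd'.contDiffAt (Metric.ball_mem_nhds _ hr)
  · filter_upwards [Metric.ball_mem_nhds (c y) hr] with a ha
    refine (congrFun hpe _).trans ?_
    rw [Function.comp_apply, β.right_inv (by rwa [hβt])]

/-- Smoothness of a form can be tested on frames. -/
theorem Form.smoothAt_of_frame [IsManifold 𝓘(ℝ, Euc n) ∞ M] {p : ℕ} (θ : Form n M p) (y : M)
    (B : PrincipalBundle n M EG G EP P)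
    (h : ∀ e : Frame B, e.base 0 = y → ContDiffAt ℝ ∞ (θ.onEuc e.base) 0) : θ.SmoothAt y := by
  obtain ⟨e, g, hey, hg0, hg, heg⟩ := exists_frame B y
  have h1 : θ.inChart y =ᶠ[𝓝 (extChartAt 𝓘(ℝ, Euc n) y y)] fun a =>
      (θ.onEuc e.base (g a)).compContinuousLinearMap (fderiv ℝ g a) := by
    have h2 : ∀ᶠ a in 𝓝 (extChartAt 𝓘(ℝ, Euc n) y y), ContDiffAt ℝ 1 g a :=
      (hg.of_le (by simp)).eventually (by simp)
    filter_upwards [h2, heg.eventually_nhds] with a hga hea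
    have h3 : e.base ∘ g =ᶠ[𝓝 a] (extChartAt 𝓘(ℝ, Euc n) y).symm := hea
    have h4 : derivAt n n (extChartAt 𝓘(ℝ, Euc n) y).symm a =
        (derivAt n n e.base (g a)).comp (fderiv ℝ g a) := by
      rw [← derivAt_eq_fderiv, ← derivAt_comp (e.contMDiff_base.mdifferentiable (by simp) _)
        (hga.contMDiffAt.mdifferentiableAt one_ne_zero)]
      exact h3.symm.mfderiv_eq
    rw [Form.inChart_eq_onEuc, Form.onEuc, h4, ← h3.eq_of_nhds]
    rfl
  refine ⟨ContDiffAt.congr_of_eventuallyEq ?_ h1⟩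
  have h5 : ContDiffAt ℝ ∞ (θ.onEuc e.base) (g (extChartAt 𝓘(ℝ, Euc n) y y)) := by
    rw [hg0]; exact h e hey
  exact contDiffAt_compContinuousLinearMap (ContDiffAt.comp (g := θ.onEuc e.base) _ h5 hg)
    (hg.fderiv_right (m := ∞) (by simp))

end Frames

/-! ### Local forms at fixed fields -/

section Locality

variable {n : ℕ} {M : Type u} [TopologicalSpace M] [ChartedSpace (Euc n) M]
  {EG : Type v₁} [NormedAddCommGroup EG] [NormedSpace ℝ EG]
  {G : Type v} [TopologicalSpace G] [ChartedSpace EG G] [Group G] [LieGroup 𝓘(ℝ, EG) ∞ G]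
  {EP : Type w₁} [NormedAddCommGroup EP] [NormedSpace ℝ EP]
  {P : Type w} [TopologicalSpace P] [ChartedSpace EP P]
  {B : PrincipalBundle n M EG G EP P} {r s : ℕ} {Y : GaugeFibre.{v, v₁, x} n EG G r s}

theorem contDiffAt_jet {A : Type*} [NormedAddCommGroup A] [NormedSpace ℝ A] {l : ℕ}
    {g : Euc n → A} {a : Euc n} (hg : ContDiffAt ℝ ∞ g a) : ContDiffAt ℝ ∞ (jet l g) a :=
  contDiffAt_pi.2 fun m => hg.iteratedFDeriv_right (m := ∞) (i := m) (by
    norm_cast)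

theorem jet_congr {A : Type*} [NormedAddCommGroup A] [NormedSpace ℝ A] {l : ℕ}
    {g g' : Euc n → A} {a : Euc n} (h : g =ᶠ[𝓝 a] g') : jet l g a = jet l g' a :=
  funext fun m => (h.iteratedFDeriv ℝ m).eq_of_nhds

theorem Field.inDomain_zero (φ : Field B Y) (e : Frame B) : φ.InDomain e (φ.toFun e) 0 := by
  rw [Field.InDomain, Frame.translate_zero]
  exact ⟨mem_chart_source _ _, fun i => mem_baseSet_trivializationAt _ _ _⟩

theorem Field.eventually_inDomain (φ : Field B Y) (e : Frame B) :
    ∀ᶠ a in 𝓝 0, φ.InDomain e (φ.toFun e) a := by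
  have h1 : ContinuousAt (fun a => φ.toFun (e.translate a)) 0 :=
    (φ.smooth e).continuous.continuousAt
  have h2 := φ.inDomain_zero e
  refine (h1.eventually ((chartAt Y.EZ (φ.toFun e)).open_source.mem_nhds h2.1)).and
    (eventually_all.2 fun i => h1.eventually
      ((trivializationAt (Y.F i) (Y.V i) (φ.toFun e)).open_baseSet.mem_nhds (h2.2 i)))

theorem Field.contDiffAt_rep (φ : Field B Y) (e : Frame B) :
    ContDiffAt ℝ ∞ (φ.rep e (φ.toFun e)) 0 :=
  (ContMDiffAt.comp (0 : Euc n) (contMDiffAt_extChartAt' (φ.inDomain_zero e).1)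
    (φ.smooth e 0)).contDiffAt

theorem contDiffAt_secRep {φ : Field B Y} {i : Y.ι} (ψ : Sec φ i) (e : Frame B) :
    ContDiffAt ℝ ∞ (secRep ψ e (φ.toFun e)) 0 := by
  have h1 := (contMDiffAt_totalSpace.1 (ψ.2.2 e 0)).2.contDiffAt
  rw [Frame.translate_zero] at h1
  exact h1

/-- At fixed (smooth) fields, a local form is a smooth form on `M`. -/
theorem IsLocal.smoothAt [IsManifold 𝓘(ℝ, Euc n) ∞ M] {p : ℕ} {f : GMap B Y (Form n M p)}
    (hf : IsLocal f) (φ : Field B Y) (k : ℕ) (j : Fin k → Y.ι) (ψ : ∀ a, Sec φ (j a)) (y : M) :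
    (f φ k j ψ).SmoothAt y := by
  refine Form.smoothAt_of_frame _ y B fun e _ => ?_
  obtain ⟨l, K, U, hU, hmem, h⟩ := hf e φ
  obtain ⟨H, hH, hfH⟩ := h k j
  have h1 : ContDiffAt ℝ ∞ (fun a => ((a, jet l (φ.rep e (φ.toFun e)) a) :
      Euc n × JetSpace n l Y.EZ)) 0 :=
    contDiffAt_id.prodMk (contDiffAt_jet (φ.contDiffAt_rep e))
  have h2 : ContDiffAt ℝ ∞ (fun a => (((a, jet l (φ.rep e (φ.toFun e)) a),
      fun c => jet l (secRep (ψ c) e (φ.toFun e)) a) :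
      (Euc n × JetSpace n l Y.EZ) × (∀ a, JetSpace n l (Y.F (j a))))) 0 :=
    h1.prodMk (contDiffAt_pi.2 fun c => contDiffAt_jet (contDiffAt_secRep (ψ c) e))
  refine ContDiffAt.congr_of_eventuallyEq
    (ContDiffAt.comp (g := H) 0 (hH.contDiffAt ((hU.prod isOpen_univ).mem_nhds ⟨hmem, mem_univ _⟩))
      h2) ?_
  filter_upwards [φ.eventually_inDomain e, h1.continuousAt.eventually (hU.mem_nhds hmem)]
    with a ha haU
  exact (hfH φ ψ a ha haU).1

/-- The value of a local form at a point of `M` depends only on the germs of the graded fields. -/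
theorem IsLocal.congr_germ [IsManifold 𝓘(ℝ, Euc n) ∞ M] {p : ℕ} {f : GMap B Y (Form n M p)}
    (hf : IsLocal f) {φ : Field B Y} {k : ℕ} {j : Fin k → Y.ι} {ψ ψ' : ∀ a, Sec φ (j a)} {y : M}
    (h : ∀ᶠ z in 𝓝 y, ∀ e : Frame B, e.base 0 = z → ∀ a, (ψ a).1 e = (ψ' a).1 e) :
    f φ k j ψ y = f φ k j ψ' y := by
  obtain ⟨e, -, rfl, -⟩ := exists_frame B y
  obtain ⟨l, K, U, hU, hmem, h'⟩ := hf e φ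
  obtain ⟨H, -, hfH⟩ := h' k j
  have h1 : ∀ c, secRep (ψ c) e (φ.toFun e) =ᶠ[𝓝 0] secRep (ψ' c) e (φ.toFun e) := fun c => by
    filter_upwards [e.contMDiff_base.continuous.continuousAt.eventually h] with a ha
    rw [secRep, secRep, ha (e.translate a) (e.base_translate_zero a) c]
  have h2 := (hfH φ ψ 0 (φ.inDomain_zero e) hmem).1
  have h3 := (hfH φ ψ' 0 (φ.inDomain_zero e) hmem).1
  rw [← funext fun c => jet_congr (l := l) (h1 c), ← h2] at h3
  ext v
  choose v' hv' using fun i => (e.2.2 0).2 (v i)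
  have h4 := congrArg (fun A : Euc n [⋀^Fin p]→L[ℝ] ℝ => A v') h3
  have h5 : v = fun i => mfderiv 𝓘(ℝ, Euc n) 𝓘(ℝ, Euc n) e.base 0 (v' i) :=
    (funext hv').symm
  rw [h5]
  exact h4.symm

/-- The product of a section of the graded part with a smooth function on `M`. -/
noncomputable def smulSec {φ : Field B Y} {i : Y.ι} (χ : M → ℝ)
    (hχ : ContMDiff 𝓘(ℝ, Euc n) 𝓘(ℝ, ℝ) ∞ χ)
    (ψ : Sec φ i) : Sec φ i :=
  ⟨fun e => χ (e.base 0) • ψ.1 e, by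
    refine ⟨fun e h => ?_, fun e a => ?_⟩
    · have h1 : (e.gauge h).base 0 = e.base 0 := by
        change B.proj (B.act (e.1 (h.α 0)) (h.a 0)) = B.proj (e.1 0)
        rw [B.proj_act, h.α_zero]
      have h2 := total_smul (χ (e.base 0)) (ψ.2.1 e h)
      rw [← map_smul, ← h1] at h2
      simpa only [h1] using h2
    · have h1 := contMDiffAt_totalSpace.1 (ψ.2.2 e a)
      refine contMDiffAt_totalSpace.2 ⟨h1.1, ?_⟩
      have h2 : ContMDiffAt 𝓘(ℝ, Euc n) 𝓘(ℝ, ℝ) ∞ (fun b => χ ((e.translate b).base 0)) a := by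
        simp only [Frame.base_translate_zero]
        exact (hχ _).comp a (e.contMDiff_base a)
      refine (h2.smul h1.2).congr_of_eventuallyEq ?_
      have h3 : ∀ᶠ b in 𝓝 a, φ.toFun (e.translate b) ∈
          (trivializationAt (Y.F i) (Y.V i) (φ.toFun (e.translate a))).baseSet :=
        h1.1.continuousAt.eventually_mem
          ((trivializationAt (Y.F i) (Y.V i) (φ.toFun (e.translate a))).open_baseSet.mem_nhds
            (mem_baseSet_trivializationAt _ _ _))
      filter_upwards [h3] with b hb
      exact ((trivializationAt (Y.F i) (Y.V i) (φ.toFun (e.translate a))).linear ℝ hb).map_smul _ _⟩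

/-! ### Vanishing of integrals of horizontally exact forms -/

theorem Submfd.integrate_zero {p : ℕ} (γ : Submfd n M p) : γ.integrate 0 = 0 := by
  have h1 : (0 : Form n M p).pullback γ.incl = (0 : Form p γ.carrier p) := by
    ext x v; rfl
  rw [Submfd.integrate, h1, integral_eq_finsum_density]
  have h2 : ∀ y a, γ.orientation.density 0 y a = 0 := fun y a =>
    γ.orientation.density_eq_zero rfl
  simp [h2]

variable [IsManifold 𝓘(ℝ, EP) ∞ P] [IsManifold 𝓘(ℝ, Euc n) ∞ M]

/-- Stokes' theorem over a submanifold for a form on the ambient manifold. -/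
theorem Submfd.integrate_d_eq_zero {p : ℕ} (γ : Submfd n M (p + 1)) {θ : Form n M p}
    (hθ : ∀ y, θ.SmoothAt y) {K : Set γ.carrier} (hK : IsCompact K)
    (h0 : ∀ x ∉ K, θ (γ.incl x) = 0) : γ.integrate θ.d = 0 := by
  have h1 : θ.d.pullback γ.incl = (θ.pullback γ.incl : Form (p + 1) γ.carrier p).d :=
    funext fun x => ((hθ (γ.incl x)).d_pullback γ.contMDiff_incl).symm
  rw [Submfd.integrate, h1]
  refine integral_d_eq_zero γ.orientation (fun x => (hθ _).pullback γ.contMDiff_incl) hK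
    fun x hx => ?_
  rw [Form.pullback, h0 x hx]
  ext v; rfl

theorem IsDhExact.int_eq_zero {p : ℕ} {f : GMap B Y (Form n M p)} (hf : IsDhExact f)
    (γ : Submfd n M p) [CompactSpace γ.carrier] : f.int γ = 0 := by
  cases p with
  | zero =>
    obtain rfl : f = 0 := hf
    ext φ k j ψ
    exact γ.integrate_zero
  | succ p =>
    obtain ⟨f', rfl⟩ := hf
    ext φ k j ψ
    exact γ.integrate_d_eq_zero (f'.2.2.2.smoothAt φ k j ψ) isCompact_univ
      fun x hx => absurd (mem_univ x) hx

variable [T2Space M] [SigmaCompactSpace M]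

/-- The integral of `d_h α` vanishes also when only `d_h α`, and not `α`, has compact support,
provided that `α` has non-zero ghost number. Then `α` depends linearly on at least one graded field,
and multiplying this field by a cutoff function, equal to `1` near the support of `d_h α`, makes
`α` compactly supported without changing `d_h α`. -/
theorem IsDhExactGhost.int_eq_zero {d : ℤ} (hd : d ≠ 0) {p : ℕ} {f : GMap B Y (Form n M p)}
    (hf : IsDhExactGhost d f) {γ : Submfd n M p} (hγ : IsClosedEmbedding γ.incl) {C : Set M}
    (hC : IsCompact C) (h0 : ∀ (φ : Field B Y) (k : ℕ) (j : Fin k → Y.ι) (ψ : ∀ a, Sec φ (j a)),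
      ∀ y ∉ C, f φ k j ψ y = 0) : f.int γ = 0 := by
  classical
  cases p with
  | zero =>
    obtain rfl : f = 0 := hf
    ext φ k j ψ
    exact γ.integrate_zero
  | succ p =>
    obtain ⟨f', hghost, rfl⟩ := hf
    have : LocallyCompactSpace M := ChartedSpace.locallyCompactSpace (Euc n) M
    obtain ⟨K, hK, hCK⟩ := exists_compact_superset hC
    obtain ⟨χ, hχ1, hχ0, -⟩ := exists_contMDiffMap_one_nhds_of_subset_interior (n := ⊤)
      𝓘(ℝ, Euc n) hC.isClosed hCK
    ext φ k j ψ
    change γ.integrate (f'.1 φ k j ψ).d = 0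
    by_cases hdeg : ∑ a, Y.deg (j a) = d
    · -- The empty sum of degrees is `0 ≠ d`, so there is a graded field to cut off.
      obtain ⟨a₀⟩ : Nonempty (Fin k) := by
        by_contra hne
        rw [not_nonempty_iff] at hne
        exact hd (by rw [← hdeg, Finset.univ_eq_empty, Finset.sum_empty])
      let ψ' : ∀ a, Sec φ (j a) := Function.update ψ a₀ (smulSec χ χ.2 (ψ a₀))
      have h1 : (f'.1 φ k j ψ).d = (f'.1 φ k j ψ').d := by
        funext y
        by_cases hy : y ∈ C
        · refine Form.d_congr ?_
          have h2 : ∀ᶠ z in 𝓝 y, χ z = 1 := hχ1.filter_mono (nhds_le_nhdsSet hy)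
          filter_upwards [h2.eventually_nhds] with z hz
          refine f'.2.2.2.congr_germ ?_
          filter_upwards [hz] with z' hz' e he a
          by_cases ha : a = a₀
          · subst ha
            simp only [ψ', Function.update_self]
            change _ = χ (e.base 0) • (ψ a).1 e
            rw [he, hz', one_smul]
          · simp only [ψ', Function.update_of_ne ha]
        · exact (h0 φ k j ψ y hy).trans (h0 φ k j ψ' y hy).symm
      rw [h1]
      refine γ.integrate_d_eq_zero (f'.2.2.2.smoothAt φ k j ψ') (hγ.isCompact_preimage hK)
        fun x hx => ?_
      let ψ₀ : ∀ a, Sec φ (j a) := Function.update ψ a₀ 0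
      have h2 : f'.1 φ k j ψ' (γ.incl x) = f'.1 φ k j ψ₀ (γ.incl x) := by
        refine f'.2.2.2.congr_germ ?_
        filter_upwards [hK.isClosed.isOpen_compl.mem_nhds hx] with z hz e he a
        by_cases ha : a = a₀
        · subst ha
          simp only [ψ', ψ₀, Function.update_self]
          change χ (e.base 0) • (ψ a).1 e = 0
          rw [he, hχ0 z hz, zero_smul]
        · simp only [ψ', ψ₀, Function.update_of_ne ha]
      obtain ⟨L, hL⟩ := f'.2.1 φ k j
      rw [h2, hL, L.map_coord_zero a₀ (Function.update_self _ _ _)]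
      rfl
    · have h1 : f'.1 φ k j ψ = 0 := hghost φ k j ψ hdeg
      rw [h1]
      refine γ.integrate_d_eq_zero (θ := 0) (fun y => ?_) isCompact_empty fun _ _ => rfl
      rw [← h1]
      exact f'.2.2.2.smoothAt φ k j ψ y

end Locality

/-! ### Invariance up to `Q`-exact terms -/

section Invariance

variable {n : ℕ} {M : Type u} [TopologicalSpace M] [ChartedSpace (Euc n) M]
  {EG : Type v₁} [NormedAddCommGroup EG] [NormedSpace ℝ EG]
  {G : Type v} [TopologicalSpace G] [ChartedSpace EG G] [Group G] [LieGroup 𝓘(ℝ, EG) ∞ G]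
  {EP : Type w₁} [NormedAddCommGroup EP] [NormedSpace ℝ EP]
  {P : Type w} [TopologicalSpace P] [ChartedSpace EP P] [IsManifold 𝓘(ℝ, EP) ∞ P]
  {B : PrincipalBundle n M EG G EP P} {r s : ℕ} {Y : GaugeFibre.{v, v₁, x} n EG G r s}

/-- A vertical local vector field does not enlarge the support of a local form in `M`, since it
commutes with evaluation at points of `M`. -/
theorem VertField.lie_eq_zero {d : ℤ} (D : VertField B Y d) {p : ℕ} {f : LocForm B Y p} {y : M}
    (h : ∀ (φ : Field B Y) (k : ℕ) (j : Fin k → Y.ι) (ψ : ∀ a, Sec φ (j a)), f.1 φ k j ψ y = 0)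
    (φ : Field B Y) (k : ℕ) (j : Fin k → Y.ι) (ψ : ∀ a, Sec φ (j a)) :
    (D.lie p f).1 φ k j ψ y = 0 := by
  ext v
  have h1 : (0 : Loc B Y).1 = f.1.evalAt y v := by
    funext φ k j ψ
    change (0 : ℝ) = f.1 φ k j ψ y v
    rw [h]
    rfl
  have h2 := D.act_evalAt p f y v 0 h1
  rw [map_zero] at h2
  exact (congrFun (congrFun (congrFun (congrFun h2 φ) k) j) ψ).symm

/-- If `[Q, K] = ξ` and `[Q, K'] = 0` as graded commutators of odd maps, then
`[Q, K + t K'] = ξ`. -/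
theorem eq_comp_add_comp_of_deformation {V : Type*} [AddCommGroup V] [Module ℝ V]
    {Q K K' Kt ξ : V →ₗ[ℝ] V} {t : ℝ} (hK : Q ∘ₗ K - (-1 : ℝ) • (K ∘ₗ Q) = ξ)
    (hK' : Q ∘ₗ K' - (-1 : ℝ) • (K' ∘ₗ Q) = 0) (hKt : Kt = K + t • K') :
    ξ = Q ∘ₗ Kt + Kt ∘ₗ Q := by
  have h : Q ∘ₗ K' = -(K' ∘ₗ Q) := by
    rw [sub_eq_zero] at hK'
    rw [hK', neg_one_smul]
  rw [← hK, hKt, LinearMap.comp_add, LinearMap.comp_smul, h, LinearMap.add_comp,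
    LinearMap.smul_comp]
  module

theorem DeformedQKG.xi_act_eq (T : DeformedQKG B Y) (Ξ : InvField B) (F : Loc B Y) :
    (T.xi Ξ).act F = T.Q.act ((T.Kt Ξ).act F) + (T.Kt Ξ).act (T.Q.act F) := by
  have h1 : koszul 1 (-1) = -1 := if_pos ⟨odd_one, by decide⟩
  have h2 := T.Q_K Ξ
  have h3 := T.Q_K' Ξ
  rw [VertField.bracket, h1] at h2 h3
  exact LinearMap.congr_fun (eq_comp_add_comp_of_deformation h2 h3 (T.Kt_act Ξ)) F

/-- The homotopy formula behind the invariance: `ξ_Ξ = [Q, K_Ξ]`, so the term `K_Ξ (Q ∫_γ f)` is all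
that separates `ξ_Ξ ∫_γ f` from the `Q`-exact one, and it vanishes if `∫_γ Q f` does. -/
theorem CohTheory.invariantUpToQExact_of_int_eq_zero (T : CohTheory B Y) {p : ℕ}
    {γ : Submfd n M p} {f : LocForm B Y p} (Ξ : InvField B) (hf : f.1.CompactAlong γ)
    (hK : ((T.Kt Ξ).lie p f).1.CompactAlong γ) (hQ : (T.Q.lie p f).1.int γ = 0) :
    T.InvariantUpToQExact γ f Ξ := by
  have hF : f.1.int γ ∈ Loc B Y := Submodule.subset_span ⟨p, γ, f, hf, rfl⟩
  have hH : ((T.Kt Ξ).lie p f).1.int γ ∈ Loc B Y := Submodule.subset_span ⟨p, γ, _, hK, rfl⟩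
  have h1 : T.Q.act ⟨_, hF⟩ = 0 := Subtype.ext ((T.Q.act_int p f γ hf ⟨_, hF⟩ rfl).trans hQ)
  have h2 : (T.Kt Ξ).act ⟨_, hF⟩ = ⟨_, hH⟩ := Subtype.ext ((T.Kt Ξ).act_int p f γ hf ⟨_, hF⟩ rfl)
  refine ⟨⟨_, hF⟩, ⟨_, hH⟩, rfl, rfl, ?_⟩
  rw [DeformedQKG.xi_act_eq, h1, map_zero, add_zero, h2]

variable [IsManifold 𝓘(ℝ, Euc n) ∞ M]

theorem CohTheory.IsPreobservable.invariantUpToQExact {T : CohTheory B Y} {p : ℕ}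
    {f : LocForm B Y p} (hf : T.IsPreobservable f) (γ : Submfd n M p) [CompactSpace γ.carrier]
    (Ξ : InvField B) : T.InvariantUpToQExact γ f Ξ := by
  have h1 : ∀ g : LocForm B Y p, g.1.CompactAlong γ := fun g =>
    ⟨univ, isCompact_univ, fun _ _ _ _ y hy => absurd (mem_univ y) hy⟩
  exact T.invariantUpToQExact_of_int_eq_zero Ξ (h1 _) (h1 _) (IsDhExact.int_eq_zero hf γ)

theorem CohTheory.invariantUpToQExact_lagrangian [T2Space M] [SigmaCompactSpace M]
    (T : CohTheory B Y) (o : MfdOrientation n M) (Ξ : InvField B) :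
    T.InvariantUpToQExact (Submfd.whole o) T.lagrangian Ξ := by
  obtain ⟨C, hC, hL⟩ := T.compact_lagrangian
  have h1 : ∀ g : LocForm B Y n, (∀ (φ : Field B Y) (k : ℕ) (j : Fin k → Y.ι)
      (ψ : ∀ a, Sec φ (j a)), ∀ y ∉ C, g.1 φ k j ψ y = 0) →
      g.1.CompactAlong (Submfd.whole o) := fun g hg =>
    ⟨C, hC, fun φ k j ψ y hy => by
      have h2 : g.1 φ k j ψ ((Submfd.whole o).incl y) = 0 := hg φ k j ψ y hy
      rw [Form.pullback, h2]
      ext v; rfl⟩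
  have h2 : ∀ {d : ℤ} (D : VertField B Y d) (φ : Field B Y) (k : ℕ) (j : Fin k → Y.ι)
      (ψ : ∀ a, Sec φ (j a)), ∀ y ∉ C, (D.lie n T.lagrangian).1 φ k j ψ y = 0 :=
    fun D φ k j ψ y hy => D.lie_eq_zero (fun φ k j ψ => hL φ k j ψ y hy) φ k j ψ
  exact T.invariantUpToQExact_of_int_eq_zero Ξ (h1 _ hL) (h1 _ (h2 _))
    (IsDhExactGhost.int_eq_zero one_ne_zero T.Q_noether IsClosedEmbedding.id hC (h2 _))

end Invariance

end CohLFT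

open CohLFT in
theorem mainTheorem7 {n : ℕ} {M : Type u} [TopologicalSpace M] [ChartedSpace (Euc n) M]
    [IsManifold 𝓘(ℝ, Euc n) ∞ M] [T2Space M] [SigmaCompactSpace M]
    (o : MfdOrientation n M) :
    -- cohomological Lagrangian field theories
    (∀ (s : ℕ) (Y : GaugeFibre.{0, 0, x} n PUnit.{1} PUnit.{1} 0 s)
      (T : CohTheory (trivialBundle n M) Y)
      (X : ∀ y : M, TangentSpace 𝓘(ℝ, Euc n) y)
      (hX : ContMDiff 𝓘(ℝ, Euc n) 𝓘(ℝ, Euc n).tangent ∞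
        (fun y => (⟨y, X y⟩ : TangentBundle 𝓘(ℝ, Euc n) M))),
      (∀ (p : ℕ) (O : LocForm (trivialBundle n M) Y p), T.IsPreobservable O →
        ∀ γ : Submfd n M p, CompactSpace γ.carrier →
          T.InvariantUpToQExact γ O (InvField.ofVectorField X hX)) ∧
      T.InvariantUpToQExact (Submfd.whole o) T.lagrangian (InvField.ofVectorField X hX)) ∧
    -- cohomological Lagrangian gauge field theories
    (∀ {EG : Type v₁} [NormedAddCommGroup EG] [NormedSpace ℝ EG] [FiniteDimensional ℝ EG]
      {G : Type v} [TopologicalSpace G] [ChartedSpace EG G] [Group G] [LieGroup 𝓘(ℝ, EG) ∞ G]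
      {EP : Type w₁} [NormedAddCommGroup EP] [NormedSpace ℝ EP] [FiniteDimensional ℝ EP]
      {P : Type w} [TopologicalSpace P] [ChartedSpace EP P] [IsManifold 𝓘(ℝ, EP) ∞ P]
      (B : PrincipalBundle n M EG G EP P) (r s : ℕ)
      (Y : GaugeFibre.{v, v₁, x} n EG G r s)
      (T : CohGaugeTheory B Y) (Ξ : InvField B),
      (∀ (p : ℕ) (O : LocForm B Y p), T.IsPreobservable O →
        ∀ γ : Submfd n M p, CompactSpace γ.carrier →
          T.InvariantUpToQExact γ O Ξ) ∧
      T.InvariantUpToQExact (Submfd.whole o) T.lagrangian Ξ) := by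
  refine ⟨fun s Y T X hX => ⟨fun p O hO γ _ => hO.invariantUpToQExact γ _,
    T.invariantUpToQExact_lagrangian o _⟩, ?_⟩
  intro EG _ _ _ G _ _ _ _ EP _ _ _ P _ _ _ B r s Y T Ξ
  exact ⟨fun p O hO γ _ => hO.1.invariantUpToQExact γ Ξ,
    T.toCohTheory.invariantUpToQExact_lagrangian o Ξ⟩
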